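/- All graphs are finite and ribbon graphs (combinatorial maps) are orientable: a ribbon graph is a set of half-edges with a cyclic (counterclockwise) order around each vertex and a pairing of some half-edges into edges; an unpaired half-edge is a cilium. Loops and multiple edges are allowed. Graphs are counted up to isomorphism, i.e. bijections of half-edges preserving the cyclic orders, the pairing and all additional data (orientations, colors, marks). For a connected ribbon graph the genus $g$ is given by $|V|-|E|+|F|=2-2g$, where $F$ is the set of all faces, with or without cilia. An alternating 2-in 2-out ribbon graph with external legs is a ribbon graph with oriented edges, every vertex of which is either four-valent, with two incoming and two outgoing half-edges alternating around it, or univalent (the end of an external leg: a source or a sink); "vertices" refers to the four-valent ones. A single edge joining a source to a sink is allowed ($n=0$, $2m=2$). The faces, or the pieces of faces between two successive external legs, which lie on the left of all edges bounding them are called black; a black piece goes from a source to a sink. **Proposition.** (i) Let $n,m\ge 0$ with $n+m\ge1$. There is a bijection $$\{\text{connected alternating 2-in 2-out ribbon graphs with } n \text{ vertices and } 2m \text{ external legs}\}\;\longleftrightarrow\;\{\text{connected ribbon graphs with } n \text{ edges, at most one cilium per vertex and } m \text{ ciliated vertices}\}$$ which is given by the intermediate field representation. From left to right: the source and sink at the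 two ends of each black piece are joined into a cilium, the black faces (ciliated or not) become the vertices, with the cyclic order along their boundary, and each four-valent vertex becomes an edge joining its two black corners. From right to left (the inverse map): each vertex is expanded into a black face, each cilium is cut into a source and a sink, and each edge is contracted into a four-valent vertex. (ii) Let $g,m\ge0$ and $n\ge1$. A bipartite quadrangulation is a connected ribbon graph without cilia, with its vertices colored black and white (the coloring being part of the data) so that each edge joins vertices of different colors, and all of whose faces have degree four. There is a bijection $$\{\text{bipartite quadrangulations of genus } g \text{ with } n \text{ faces and } m \text{ marked edges}\}\;\longleftrightarrow\;\{\text{connected ribbon graphs of genus } g \text{ with } n \text{ edges and } m \text{ cilia}\},$$ where on the right there is at most one cilium in each corner (no two distinct cilia are consecutive around a vertex; a vertex may carry several cilia). It sends a quadrangulation to the graph whose vertices are its black vertices, with one edge in each face joining the two black corners of that face, and with one cilium for every marked edge, placed at its black end. -/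

import Mathlib

namespace IntermediateField

/-! ### Ribbon graphs

A ribbon graph (combinatorial map) is given by its finite set `H` of half-edges, the permutation
`rot` sending a half-edge to the next one in counterclockwise order around its vertex, and the
involution `flip` exchanging the two half-edges of every edge. A half-edge fixed by `flip`
belongs to no edge: it is a cilium, hooked to its vertex. Vertices are the cycles of `rot`; hence
every connected ribbon graph is described in this way, except the one that consists of a single
vertex without edges or cilia. -/

structure RibbonGraph where
  H : Type
  finite_H : Finite H
  rot : Equiv.Perm H
  flip : Equiv.Perm H
  flip_flip : ∀ h, flip (flip h) = h

namespace RibbonGraph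

variable (G : RibbonGraph)

/-- Vertices: cycles of half-edges around a vertex. -/
def Vertex : Type := Quotient (Equiv.Perm.SameCycle.setoid G.rot)

def vertexOf (h : G.H) : G.Vertex := Quotient.mk (Equiv.Perm.SameCycle.setoid G.rot) h

/-- One step along the boundary of the face lying on the left of a half-edge that leaves its
vertex: follow the edge to its other end, then take the next half-edge in clockwise order. -/
def faceStep : Equiv.Perm G.H := G.flip.trans G.rot.symm

/-- Faces (broken ones included): boundary components of the ribbon graph. -/
def Face : Type := Quotient (Equiv.Perm.SameCycle.setoid G.faceStep)

def IsCilium (h : G.H) : Prop := G.flip h = h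

/-- Edges: the two-element sets of half-edges exchanged by `flip`. -/
def edges : Set (Set G.H) := {e | ∃ h, ¬ G.IsCilium h ∧ e = {h, G.flip h}}

def cilia : Set G.H := {h | G.IsCilium h}

def ciliatedVertices : Set G.Vertex := {v | ∃ h, G.IsCilium h ∧ G.vertexOf h = v}

def Connected : Prop :=
  Nonempty G.H ∧ ∀ h h' : G.H, ∃ p ∈ Subgroup.closure {G.rot, G.flip}, p h = h'

/-- A connected ribbon graph has genus `g` when `|V| - |E| + |F| = 2 - 2g`. -/
def HasGenus (g : ℕ) : Prop :=
  (Nat.card G.Vertex : ℤ) - (G.edges.ncard : ℤ) + (Nat.card G.Face : ℤ) = 2 - 2 * (g : ℤ)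

def AtMostOneCiliumPerVertex : Prop :=
  ∀ c c' : G.H, G.IsCilium c → G.IsCilium c' → G.vertexOf c = G.vertexOf c' → c = c'

/-- At most one cilium in each corner: two distinct cilia are never consecutive around a
vertex. -/
def AtMostOneCiliumPerCorner : Prop :=
  ∀ c : G.H, G.IsCilium c → G.IsCilium (G.rot c) → G.rot c = c

/-- Isomorphisms of ribbon graphs. -/
def Iso (G G' : RibbonGraph) : Prop :=
  ∃ e : G.H ≃ G'.H, (∀ h, e (G.rot h) = G'.rot (e h)) ∧ (∀ h, e (G.flip h) = G'.flip (e h))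

theorem iso_equivalence : Equivalence Iso where
  refl G := ⟨Equiv.refl _, fun _ => rfl, fun _ => rfl⟩
  symm := by
    rintro G G' ⟨e, h1, h2⟩
    refine ⟨e.symm, fun h => ?_, fun h => ?_⟩
    · rw [Equiv.symm_apply_eq, h1, Equiv.apply_symm_apply]
    · rw [Equiv.symm_apply_eq, h2, Equiv.apply_symm_apply]
  trans := by
    rintro G G' G'' ⟨e, h1, h2⟩ ⟨f, k1, k2⟩
    exact ⟨e.trans f, fun h => by simp [h1, k1], fun h => by simp [h2, k2]⟩

end RibbonGraph

/-! ### Alternating 2-in 2-out ribbon graphs with external legs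

Every edge is oriented; `out h` means that the edge of `h` is oriented away from the vertex
of `h`. Every vertex is either univalent (the end of an external leg) or four-valent with
incoming and outgoing half-edges alternating around it. A univalent `out` half-edge is the end of an
incoming external leg (a source), the other univalent half-edges are ends of outgoing external
legs (sinks). The bare propagator, a single edge with two univalent ends, is allowed. -/

structure AltGraph extends RibbonGraph where
  out : H → Prop
  flip_ne : ∀ h, flip h ≠ h
  out_flip : ∀ h, out (flip h) ↔ ¬ out h
  valence : ∀ h, rot h ≠ h → Function.minimalPeriod rot h = 4 ∧ (out (rot h) ↔ ¬ out h)

namespace AltGraph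

variable (G : AltGraph)

/-- The half-edge sits at a univalent vertex. -/
def IsLeg (h : G.H) : Prop := G.rot h = h

def legs : Set G.H := {h | G.IsLeg h}

/-- The four-valent vertices. -/
def innerVertices : Set G.toRibbonGraph.Vertex := {v | ∃ h, ¬ G.IsLeg h ∧ G.vertexOf h = v}

/-- Isomorphisms preserve the orientation of the edges. -/
def Iso (G G' : AltGraph) : Prop :=
  ∃ e : G.H ≃ G'.H, (∀ h, e (G.rot h) = G'.rot (e h)) ∧ (∀ h, e (G.flip h) = G'.flip (e h)) ∧
    ∀ h, G'.out (e h) ↔ G.out h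

theorem iso_equivalence : Equivalence Iso where
  refl G := ⟨Equiv.refl _, fun _ => rfl, fun _ => rfl, fun _ => Iff.rfl⟩
  symm := by
    rintro G G' ⟨e, h1, h2, h3⟩
    refine ⟨e.symm, fun h => ?_, fun h => ?_, fun h => ?_⟩
    · rw [Equiv.symm_apply_eq, h1, Equiv.apply_symm_apply]
    · rw [Equiv.symm_apply_eq, h2, Equiv.apply_symm_apply]
    · rw [← h3, Equiv.apply_symm_apply]
  trans := by
    rintro G G' G'' ⟨e, h1, h2, h3⟩ ⟨f, k1, k2, k3⟩
    exact ⟨e.trans f, fun h => by simp [h1, k1], fun h => by simp [h2, k2],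
      fun h => by simp [h3, k3]⟩

theorem not_isLeg_rot {h : G.H} (hh : ¬ G.IsLeg h) : ¬ G.IsLeg (G.rot h) :=
  fun k => hh (G.rot.injective k)

theorem not_isLeg_symm {h : G.H} (hh : ¬ G.IsLeg h) : ¬ G.IsLeg (G.rot.symm h) := fun k => by
  apply hh
  have k' : G.rot (G.rot.symm h) = G.rot.symm h := k
  rw [Equiv.apply_symm_apply] at k'
  show G.rot h = h
  nth_rewrite 1 [k']
  simp

theorem out_rot_rot {h : G.H} (hh : ¬ G.IsLeg h) : G.out (G.rot (G.rot h)) ↔ G.out h := by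
  rw [(G.valence _ (G.not_isLeg_rot hh)).2, (G.valence _ hh).2, not_not]

theorem out_symm {h : G.H} (hh : ¬ G.IsLeg h) : G.out (G.rot.symm h) ↔ ¬ G.out h := by
  have := (G.valence _ (G.not_isLeg_symm hh)).2
  rw [Equiv.apply_symm_apply] at this
  tauto

/-- The outgoing half-edges. Those at four-valent vertices are identified with the black corners:
the corner between `o` and `rot o` lies on the left of the edge leaving along `o` and on the left of
the edge arriving along `rot o`. The univalent ones are the sources. -/
abbrev Out : Type := {h : G.H // G.out h}

instance : Finite G.Out := by
  have := G.finite_H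
  infer_instance

open Classical in
/-- The next black corner on a black piece of a face, in the direction of the edges (the last
corner of a piece that ends in a sink is fixed). -/
noncomputable def next (o : G.Out) : G.Out :=
  if h : G.IsLeg (G.flip o.1) then o
  else ⟨G.rot.symm (G.flip o.1), by rw [G.out_symm h, G.out_flip, not_not]; exact o.2⟩

open Classical in
/-- The previous element on a black piece of a face (a source is fixed). -/
noncomputable def prev (o : G.Out) : G.Out :=
  if h : G.IsLeg o.1 then o
  else ⟨G.flip (G.rot o.1), by rw [G.out_flip, (G.valence _ h).2, not_not]; exact o.2⟩

theorem next_prev {o : G.Out} (h : ¬ G.IsLeg o.1) : G.next (G.prev o) = o := by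
  have h' : ¬ G.IsLeg (G.flip (G.prev o).1) := by
    simp only [prev, h, dite_false, G.flip_flip]
    exact G.not_isLeg_rot h
  apply Subtype.ext
  rw [next, dif_neg h']
  simp [prev, h, G.flip_flip]

theorem not_isLeg_flip_prev {o : G.Out} (h : ¬ G.IsLeg o.1) :
    ¬ G.IsLeg (G.flip (G.prev o).1) := by
  simp only [prev, h, dite_false, G.flip_flip]
  exact G.not_isLeg_rot h

theorem exists_next_iterate (k : ℕ) (o : G.Out) : ∃ j, G.next^[j] (G.prev^[k] o) = o := by
  induction k generalizing o with
  | zero => exact ⟨0, rfl⟩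
  | succ k ih =>
    obtain ⟨j, hj⟩ := ih (G.prev o)
    rw [Function.iterate_succ_apply]
    by_cases h : G.IsLeg o.1
    · have : G.prev o = o := by simp [prev, h]
      exact ⟨j, by rw [hj, this]⟩
    · exact ⟨j + 1, by rw [Function.iterate_succ_apply', hj, G.next_prev h]⟩

theorem isLeg_prev_iterate {o : G.Out} (ho : G.IsLeg (G.flip o.1)) :
    G.IsLeg (G.prev^[Nat.card G.Out] o).1 := by
  by_contra hN
  have key : ∀ k ≤ Nat.card G.Out, ¬ G.IsLeg (G.prev^[k] o).1 := by
    intro k hk hleg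
    obtain ⟨d, hd⟩ := Nat.exists_eq_add_of_le hk
    have fixp : G.prev (G.prev^[k] o) = G.prev^[k] o := by simp [prev, hleg]
    rw [hd, Nat.add_comm, Function.iterate_add_apply, Function.iterate_fixed fixp] at hN
    exact hN hleg
  have inj : ∀ i d, i + (d + 1) ≤ Nat.card G.Out →
      G.prev^[i] o = G.prev^[i + (d + 1)] o → False := by
    intro i d
    induction i with
    | zero =>
      intro hle heq
      rw [Nat.zero_add, Function.iterate_succ_apply'] at heq
      have := G.not_isLeg_flip_prev (key d (by omega))
      rw [← heq] at this
      exact this ho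
    | succ i ih =>
      intro hle heq
      refine ih (by omega) ?_
      have h1 := congrArg G.next heq
      rw [show i + 1 + (d + 1) = (i + (d + 1)) + 1 by omega, Function.iterate_succ_apply',
        Function.iterate_succ_apply', G.next_prev (key i (by omega)),
        G.next_prev (key _ (by omega))] at h1
      exact h1
  have hni : ¬ Function.Injective (fun k : Fin (Nat.card G.Out + 1) => G.prev^[k.1] o) := by
    intro hi
    have := Nat.card_le_card_of_injective _ hi
    simp at this
  rw [Function.Injective] at hni
  push Not at hni
  obtain ⟨a, b, hab, hne⟩ := hni
  have hne' : a.1 ≠ b.1 := fun h => hne (Fin.ext h)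
  rcases Nat.lt_or_gt_of_ne hne' with hlt | hlt
  · obtain ⟨d, hd⟩ := Nat.exists_eq_add_of_lt hlt
    exact inj a.1 d (by omega) (by simpa [hd, Nat.add_assoc] using hab)
  · obtain ⟨d, hd⟩ := Nat.exists_eq_add_of_lt hlt
    exact inj b.1 d (by omega) (by simpa [hd, Nat.add_assoc] using hab.symm)

open Classical in
/-- The cyclic order around the boundary of a black face or of a black piece of a broken face: go
to the next black corner along the edges; from the last corner of a piece that ends in a sink, go
back to the source where this piece begins (this joins source and sink into a cilium). -/
noncomputable def blackSucc (o : G.Out) : G.Out :=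
  if G.IsLeg (G.flip o.1) then G.prev^[Nat.card G.Out] o else G.next o

theorem blackSucc_injective : Function.Injective G.blackSucc := by
  have hnext : ∀ o : G.Out, ¬ G.IsLeg (G.flip o.1) → ¬ G.IsLeg (G.next o).1 := by
    intro o ho
    rw [next, dif_neg ho]
    exact G.not_isLeg_symm ho
  intro a b hab
  by_cases ha : G.IsLeg (G.flip a.1) <;> by_cases hb : G.IsLeg (G.flip b.1)
  · simp only [blackSucc, ha, hb, if_true] at hab
    obtain ⟨i, hi⟩ := G.exists_next_iterate (Nat.card G.Out) a
    obtain ⟨j, hj⟩ := G.exists_next_iterate (Nat.card G.Out) b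
    have fa : G.next a = a := by simp [next, ha]
    have fb : G.next b = b := by simp [next, hb]
    rw [← hab] at hj
    have h1 := congrArg (G.next^[j]) hi
    have h2 := congrArg (G.next^[i]) hj
    rw [Function.iterate_fixed fa, ← Function.iterate_add_apply] at h1
    rw [Function.iterate_fixed fb, ← Function.iterate_add_apply, Nat.add_comm] at h2
    rw [← h1, ← h2]
  · simp only [blackSucc, ha, hb, if_true, if_false] at hab
    exact absurd (hab ▸ G.isLeg_prev_iterate ha) (hnext b hb)
  · simp only [blackSucc, ha, hb, if_true, if_false] at hab
    exact absurd (hab ▸ G.isLeg_prev_iterate hb) (hnext a ha)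
  · simp only [blackSucc, ha, hb, if_false, next, dite_false] at hab
    have := congrArg Subtype.val hab
    exact Subtype.ext (G.flip.injective (G.rot.symm.injective this))

open Classical in
/-- The two black corners of a four-valent vertex are exchanged, a source is fixed. -/
noncomputable def opposite (o : G.Out) : G.Out :=
  if h : G.IsLeg o.1 then o else ⟨G.rot (G.rot o.1), (G.out_rot_rot h).2 o.2⟩

theorem opposite_involutive : Function.Involutive G.opposite := by
  intro o
  by_cases h : G.IsLeg o.1
  · simp [opposite, h]
  · have h4 := Function.isPeriodicPt_minimalPeriod G.rot o.1
    rw [(G.valence _ h).1] at h4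
    have h4' : G.rot (G.rot (G.rot (G.rot o.1))) = o.1 := h4
    have h2 := G.not_isLeg_rot (G.not_isLeg_rot h)
    have h1 : G.opposite o = ⟨G.rot (G.rot o.1), (G.out_rot_rot h).2 o.2⟩ := by
      rw [opposite, dif_neg h]
    rw [h1, opposite, dif_neg h2]
    exact Subtype.ext h4'

/-- The intermediate field graph. Its half-edges are the black corners of the four-valent
vertices, together with one cilium for each incoming leg, joined with the outgoing leg at the other
end of the same black piece. Its vertices are the black faces and the black pieces of broken
faces; its edges join the two black corners of each four-valent vertex. -/
noncomputable def toIntermediate : RibbonGraph where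
  H := G.Out
  finite_H := inferInstance
  rot := Equiv.ofBijective G.blackSucc (Finite.injective_iff_bijective.1 G.blackSucc_injective)
  flip := G.opposite_involutive.toPerm
  flip_flip := G.opposite_involutive

end AltGraph

namespace RibbonGraph

variable (A : RibbonGraph)

open Classical in
/-- Rotation of the expanded graph. A half-edge `h` of `A` becomes an outgoing half-edge
`(h, true)` and an incoming one `(h, false)`. Contracting an edge `{h, h'}` of `A` gives a
four-valent vertex with cyclic order `(h, true), (h, false), (h', true), (h', false)`; a cilium is
cut into two univalent vertices. -/
noncomputable def expandRot : Equiv.Perm (A.H × Bool) where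
  toFun x := if A.IsCilium x.1 then x else if x.2 then (x.1, false) else (A.flip x.1, true)
  invFun x := if A.IsCilium x.1 then x else if x.2 then (A.flip x.1, false) else (x.1, true)
  left_inv := by
    rintro ⟨h, b⟩
    have hs : (h = A.flip h) = (A.flip h = h) := propext eq_comm
    by_cases hc : A.flip h = h <;> cases b <;> simp [IsCilium, hc, hs, A.flip_flip]
  right_inv := by
    rintro ⟨h, b⟩
    have hs : (h = A.flip h) = (A.flip h = h) := propext eq_comm
    by_cases hc : A.flip h = h <;> cases b <;> simp [IsCilium, hc, hs, A.flip_flip]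

/-- Edges of the expanded graph: the boundary arcs of the vertices of `A`, from each half-edge
or cilium to the next one in counterclockwise order. -/
def expandFlip : Equiv.Perm (A.H × Bool) where
  toFun x := if x.2 then (A.rot x.1, false) else (A.rot.symm x.1, true)
  invFun x := if x.2 then (A.rot x.1, false) else (A.rot.symm x.1, true)
  left_inv := by rintro ⟨h, b⟩; cases b <;> simp
  right_inv := by rintro ⟨h, b⟩; cases b <;> simp

/-- Expand the vertices into black faces, cut the cilia into two, and contract the edges into
four-valent vertices. -/
noncomputable def expand : AltGraph where
  H := A.H × Bool
  finite_H := by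
    have := A.finite_H
    infer_instance
  rot := A.expandRot
  flip := A.expandFlip
  flip_flip := A.expandFlip.left_inv
  out x := x.2 = true
  flip_ne := by rintro ⟨h, b⟩; cases b <;> simp [expandFlip]
  out_flip := by rintro ⟨h, b⟩; cases b <;> simp [expandFlip]
  valence := by
    rintro ⟨h, b⟩ hne
    have hc : ¬ A.IsCilium h := fun hc => hne (by simp [expandRot, hc])
    have hc' : ¬ A.IsCilium (A.flip h) := fun k => hc (A.flip.injective k)
    refine ⟨?_, by cases b <;> simp [expandRot, hc]⟩
    have h4 : Function.minimalPeriod A.expandRot (h, b) ∣ 2 ^ (1 + 1) := by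
      apply Function.IsPeriodicPt.minimalPeriod_dvd
      cases b <;>
        simp [Function.IsPeriodicPt, Function.IsFixedPt, expandRot, hc, hc', A.flip_flip]
    have h2 : ¬ Function.minimalPeriod A.expandRot (h, b) ∣ 2 ^ 1 := by
      rw [← Function.isPeriodicPt_iff_minimalPeriod_dvd]
      have hc2 : ¬ A.flip h = h := hc
      cases b <;>
        simp [Function.IsPeriodicPt, Function.IsFixedPt, expandRot, hc, hc', hc2]
    exact Nat.eq_prime_pow_of_dvd_least_prime_pow Nat.prime_two h2 h4

end RibbonGraph

/-! ### Bipartite quadrangulations with marked edges -/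

/-- A bipartite quadrangulation with marked edges: a ribbon graph without cilia, with vertices
colored black and white such that the ends of each edge have different colors, all of whose faces
have degree four, and a set of marked edges. -/
structure MarkedQuadrangulation extends RibbonGraph where
  black : H → Prop
  marked : H → Prop
  flip_ne : ∀ h, flip h ≠ h
  black_rot : ∀ h, black (rot h) ↔ black h
  black_flip : ∀ h, black (flip h) ↔ ¬ black h
  marked_flip : ∀ h, marked (flip h) ↔ marked h
  face_degree : ∀ h, Function.minimalPeriod (flip.trans rot.symm) h = 4

namespace MarkedQuadrangulation

variable (Q : MarkedQuadrangulation)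

def markedEdges : Set (Set Q.H) := {e | ∃ h, Q.marked h ∧ e = {h, Q.flip h}}

/-- Isomorphisms preserve the colors and the marked edges. -/
def Iso (Q Q' : MarkedQuadrangulation) : Prop :=
  ∃ e : Q.H ≃ Q'.H, (∀ h, e (Q.rot h) = Q'.rot (e h)) ∧ (∀ h, e (Q.flip h) = Q'.flip (e h)) ∧
    (∀ h, Q'.black (e h) ↔ Q.black h) ∧ ∀ h, Q'.marked (e h) ↔ Q.marked h

theorem iso_equivalence : Equivalence Iso where
  refl G := ⟨Equiv.refl _, fun _ => rfl, fun _ => rfl, fun _ => Iff.rfl, fun _ => Iff.rfl⟩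
  symm := by
    rintro G G' ⟨e, h1, h2, h3, h4⟩
    refine ⟨e.symm, fun h => ?_, fun h => ?_, fun h => ?_, fun h => ?_⟩
    · rw [Equiv.symm_apply_eq, h1, Equiv.apply_symm_apply]
    · rw [Equiv.symm_apply_eq, h2, Equiv.apply_symm_apply]
    · rw [← h3, Equiv.apply_symm_apply]
    · rw [← h4, Equiv.apply_symm_apply]
  trans := by
    rintro G G' G'' ⟨e, h1, h2, h3, h4⟩ ⟨f, k1, k2, k3, k4⟩
    exact ⟨e.trans f, fun h => by simp [h1, k1], fun h => by simp [h2, k2],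
      fun h => by simp [h3, k3], fun h => by simp [h4, k4]⟩

theorem black_symm (h : Q.H) : Q.black (Q.rot.symm h) ↔ Q.black h := by
  rw [← Q.black_rot, Equiv.apply_symm_apply]

theorem black_faceStep (h : Q.H) : Q.black (Q.faceStep h) ↔ ¬ Q.black h := by
  rw [← Q.black_flip, ← Q.black_symm (Q.flip h)]
  rfl

open Classical in
/-- Cyclic order around the black vertices. `Sum.inl d` is the half-edge drawn in the corner
between `d` and `Q.rot d`, and `Sum.inr d` is the cilium at the black end of the marked edge
of `d`. -/
noncomputable def blackRot :
    Equiv.Perm ({d : Q.H // Q.black d} ⊕ {d : Q.H // Q.black d ∧ Q.marked d}) where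
  toFun
    | Sum.inl d => if h : Q.marked (Q.rot d.1) then Sum.inr ⟨Q.rot d.1, (Q.black_rot _).2 d.2, h⟩
        else Sum.inl ⟨Q.rot d.1, (Q.black_rot _).2 d.2⟩
    | Sum.inr d => Sum.inl ⟨d.1, d.2.1⟩
  invFun
    | Sum.inl d => if h : Q.marked d.1 then Sum.inr ⟨d.1, d.2, h⟩
        else Sum.inl ⟨Q.rot.symm d.1, (Q.black_symm _).2 d.2⟩
    | Sum.inr d => Sum.inl ⟨Q.rot.symm d.1, (Q.black_symm _).2 d.2.1⟩
  left_inv := by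
    rintro (⟨d, hd⟩ | ⟨d, hd, hm⟩)
    · by_cases h : Q.marked (Q.rot d) <;> simp [h]
    · simp [hm]
  right_inv := by
    rintro (⟨d, hd⟩ | ⟨d, hd, hm⟩)
    · by_cases h : Q.marked d <;> simp [h]
    · simp [hm]

/-- The two black corners of each face are exchanged, cilia are fixed. -/
def blackFlip : {d : Q.H // Q.black d} ⊕ {d : Q.H // Q.black d ∧ Q.marked d} →
    {d : Q.H // Q.black d} ⊕ {d : Q.H // Q.black d ∧ Q.marked d}
  | Sum.inl d => Sum.inl ⟨Q.faceStep (Q.faceStep d.1),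
      by rw [Q.black_faceStep, Q.black_faceStep, not_not]; exact d.2⟩
  | Sum.inr d => Sum.inr d

theorem blackFlip_involutive : Function.Involutive Q.blackFlip := by
  rintro (⟨d, hd⟩ | d)
  · have h4 := Function.isPeriodicPt_minimalPeriod Q.faceStep d
    rw [show Function.minimalPeriod Q.faceStep d = 4 from Q.face_degree d] at h4
    have h4' : Q.faceStep (Q.faceStep (Q.faceStep (Q.faceStep d))) = d := h4
    simp only [blackFlip, h4']
  · rfl

/-- The intermediate field graph of a quadrangulation: its vertices are the black vertices, the
pair of black corners of each face is joined by an edge inside the face, and a cilium is added for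
every incidence of a marked edge at a black vertex. -/
noncomputable def toIntermediate : RibbonGraph where
  H := {d : Q.H // Q.black d} ⊕ {d : Q.H // Q.black d ∧ Q.marked d}
  finite_H := by
    have := Q.finite_H
    infer_instance
  rot := Q.blackRot
  flip := Q.blackFlip_involutive.toPerm
  flip_flip := Q.blackFlip_involutive

end MarkedQuadrangulation

/-! ### The four families of graphs, up to isomorphism -/

/-- Connected alternating 2-in 2-out ribbon graphs with `n` (four-valent) vertices and `2m`
external legs. -/
def AltFamily (n m : ℕ) : Type 1 :=
  {G : AltGraph // G.Connected ∧ G.innerVertices.ncard = n ∧ G.legs.ncard = 2 * m}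

/-- Connected ribbon graphs with `n` edges, at most one cilium per vertex, and `m` ciliated
vertices. -/
def CiliatedFamily (n m : ℕ) : Type 1 :=
  {A : RibbonGraph // A.Connected ∧ A.AtMostOneCiliumPerVertex ∧ A.edges.ncard = n ∧
    A.ciliatedVertices.ncard = m}

/-- Connected bipartite quadrangulations of genus `g` with `n` faces and `m` marked edges. -/
def QuadrangulationFamily (g n m : ℕ) : Type 1 :=
  {Q : MarkedQuadrangulation // Q.Connected ∧ Q.HasGenus g ∧
    Nat.card Q.toRibbonGraph.Face = n ∧ Q.markedEdges.ncard = m}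

/-- Connected ribbon graphs of genus `g` with `n` edges and `m` cilia, at most one in each
corner. -/
def GenusCiliatedFamily (g n m : ℕ) : Type 1 :=
  {A : RibbonGraph // A.Connected ∧ A.HasGenus g ∧ A.AtMostOneCiliumPerCorner ∧
    A.edges.ncard = n ∧ A.cilia.ncard = m}

instance altSetoid (n m : ℕ) : Setoid (AltFamily n m) where
  r G G' := AltGraph.Iso G.1 G'.1
  iseqv := AltGraph.iso_equivalence.comap Subtype.val

instance ciliatedSetoid (n m : ℕ) : Setoid (CiliatedFamily n m) where
  r G G' := RibbonGraph.Iso G.1 G'.1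
  iseqv := RibbonGraph.iso_equivalence.comap Subtype.val

instance quadrangulationSetoid (g n m : ℕ) : Setoid (QuadrangulationFamily g n m) where
  r G G' := MarkedQuadrangulation.Iso G.1 G'.1
  iseqv := MarkedQuadrangulation.iso_equivalence.comap Subtype.val

instance genusCiliatedSetoid (g n m : ℕ) : Setoid (GenusCiliatedFamily g n m) where
  r G G' := RibbonGraph.Iso G.1 G'.1
  iseqv := RibbonGraph.iso_equivalence.comap Subtype.val

end IntermediateField

/-! For (i), the orientation selects one half-edge of each edge of an alternating graph `G`, so all
half-edges of `G` are recovered from two copies of `G.Out`. On `G.Out` live two permutations: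
`blackSucc`, running along the black boundary and closing each broken piece from its sink to its
source, and the involution `opposite`, whose fixed points are the sources. They are the rotation and
the flip of the intermediate graph. Conversely, `blackSucc` tells which outgoing half-edge starts
the edge arriving next to a black corner, and `opposite` tells which two corners share a four-valent
vertex; together they give back `G`. Hence `expand` undoes `toIntermediate` on every alternating
graph (`expand_toIntermediate_iso`). The other composite (`toIntermediate_expand_iso`) needs at most
one cilium per vertex: cutting two cilia of one vertex would produce two black pieces, which become
two vertices.

For (ii), a quadrangulation is determined by its black half-edges, with the rotation `rotBlack`, the
exchange `opp` of the two black corners of a face, and the marks. Since faces have degree four,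
`rot_flip` expresses the rotation around white vertices through `rotBlack` and `opp`. These data are
read off the intermediate graph, with a mark seen as a cilium inserted between two consecutive
corners; this gives injectivity (`iso_of_toIntermediate_iso`). For surjectivity, `toQuadrangulation`
surrounds each edge of a given graph by a quadrangle.

The genus is preserved because white vertices correspond to faces of the intermediate graph
(`vertexEquiv`). If the latter has V vertices, E edges and F faces, the quadrangulation has V + F
vertices, 2E edges and E faces, and (V + F) - 2E + E = V - E + F. -/

namespace IntermediateField

/-! ### Two-to-one counting and cycles of permutations. -/

theorem ncard_eq_two_mul_ncard_image {α β : Type*} [Finite α] (f : α → β) (s : Set α) (i : α → α)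
    (hi : ∀ a ∈ s, i a ≠ a) (hf : ∀ a ∈ s, ∀ x, (x ∈ s ∧ f x = f a) ↔ (x = a ∨ x = i a)) :
    s.ncard = 2 * (f '' s).ncard := by
  classical
  have := Fintype.ofFinite α
  rw [Set.ncard_eq_toFinset_card', Set.ncard_eq_toFinset_card', Set.toFinset_image,
    Finset.card_eq_sum_card_image f s.toFinset, Finset.sum_const_nat (m := 2), mul_comm]
  intro b hb
  obtain ⟨a, ha, rfl⟩ := Finset.mem_image.1 hb
  rw [Set.mem_toFinset] at ha
  rw [show ({x ∈ s.toFinset | f x = f a} : Finset α) = {a, i a} by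
    ext x
    simpa using hf a ha x]
  exact Finset.card_pair (hi a ha).symm

/-- By finiteness every element of the cycle is reached by forward steps alone, so nothing has to be
checked for the inverse of `σ`. -/
theorem sameCycle_induction {α : Type*} [Finite α] {σ : Equiv.Perm α} {P : α → Prop} {a b : α}
    (h : σ.SameCycle a b) (ha : P a) (hs : ∀ x, P x → P (σ x)) : P b := by
  obtain ⟨i, rfl⟩ := h.exists_nat_pow_eq
  clear h
  induction i with
  | zero => exact ha
  | succ i ih =>
    rw [pow_succ', Equiv.Perm.mul_apply]
    exact hs _ ih

theorem sameCycle_iff_of_iterate_four {α : Type*} [Finite α] {σ : Equiv.Perm α} {a : α}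
    (h : Function.minimalPeriod σ a = 4) (b : α) :
    σ.SameCycle b a ↔ b = a ∨ b = σ a ∨ b = σ (σ a) ∨ b = σ (σ (σ a)) := by
  have h4 : σ (σ (σ (σ a))) = a := by
    have := Function.isPeriodicPt_minimalPeriod σ a
    rwa [h] at this
  constructor
  · intro hab
    refine sameCycle_induction (P := fun x => x = a ∨ x = σ a ∨ x = σ (σ a) ∨ x = σ (σ (σ a)))
      hab.symm (Or.inl rfl) ?_
    rintro x (rfl | rfl | rfl | rfl) <;> simp [h4]
  · rintro (rfl | rfl | rfl | rfl) <;> simp [Equiv.Perm.SameCycle.refl]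

theorem apply_apply_ne_of_minimalPeriod_eq_four {α : Type*} {f : α → α} {a : α}
    (h : Function.minimalPeriod f a = 4) : f (f a) ≠ a := fun h2 => by
  have : Function.IsPeriodicPt f 2 a := h2
  have := this.minimalPeriod_le (by norm_num)
  omega

/-! ### Connectivity and counts for ribbon graphs. -/

namespace RibbonGraph

/-- The orbits of the generated group are the smallest sets stable under both permutations. In this
form connectivity passes between graphs with different half-edges by transporting stable predicates,
without words in the generators. -/
theorem connected_iff (G : RibbonGraph) : G.Connected ↔ Nonempty G.H ∧
    ∀ P : G.H → Prop, (∀ h, P (G.rot h) ↔ P h) → (∀ h, P (G.flip h) ↔ P h) →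
      ∀ h h', P h → P h' := by
  refine and_congr_right fun _ => ⟨fun hc P hr hf h h' hP => ?_, fun hc h h' => ?_⟩
  · obtain ⟨p, hp, rfl⟩ := hc h h'
    have key : ∀ x, P (p x) ↔ P x := by
      induction hp using Subgroup.closure_induction with
      | mem p hp =>
        rcases hp with rfl | rfl
        exacts [hr, hf]
      | one => exact fun x => Iff.rfl
      | mul p q _ _ hp hq => exact fun x => (hp _).trans (hq x)
      | inv p _ hp =>
        intro x
        rw [← hp (p⁻¹ x), ← Equiv.Perm.mul_apply, mul_inv_cancel, Equiv.Perm.one_apply]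
    exact (key h).2 hP
  · have hinv : ∀ s ∈ Subgroup.closure {G.rot, G.flip}, ∀ x,
        (∃ p ∈ Subgroup.closure {G.rot, G.flip}, p h = s x) ↔
          ∃ p ∈ Subgroup.closure {G.rot, G.flip}, p h = x := by
      refine fun s hs x => ⟨?_, ?_⟩
      · rintro ⟨p, hp, hx⟩
        exact ⟨s⁻¹ * p, mul_mem (inv_mem hs) hp, by simp [hx]⟩
      · rintro ⟨p, hp, hx⟩
        exact ⟨s * p, mul_mem hs hp, by simp [hx]⟩
    exact hc (fun x => ∃ p ∈ Subgroup.closure {G.rot, G.flip}, p h = x)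
      (hinv _ (Subgroup.subset_closure (by simp))) (hinv _ (Subgroup.subset_closure (by simp)))
      h h' ⟨1, one_mem _, rfl⟩

theorem edges_eq_image (G : RibbonGraph) :
    G.edges = (fun h => ({h, G.flip h} : Set G.H)) '' {h | ¬ G.IsCilium h} := by
  ext e
  simp [edges, eq_comm]

theorem pair_flip_eq_iff (G : RibbonGraph) (h x : G.H) :
    ({x, G.flip x} : Set G.H) = {h, G.flip h} ↔ x = h ∨ x = G.flip h := by
  constructor
  · intro he
    have : x ∈ ({h, G.flip h} : Set G.H) := he ▸ Set.mem_insert _ _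
    simpa using this
  · rintro (rfl | rfl)
    · rfl
    · rw [G.flip_flip, Set.pair_comm]

theorem ncard_not_isCilium (G : RibbonGraph) :
    {h | ¬ G.IsCilium h}.ncard = 2 * G.edges.ncard := by
  have := G.finite_H
  rw [edges_eq_image]
  refine ncard_eq_two_mul_ncard_image _ _ G.flip (fun a ha => ha) fun a ha x => ?_
  rw [pair_flip_eq_iff, and_iff_right_iff_imp]
  rintro (rfl | rfl)
  · exact ha
  · exact fun hc => ha (G.flip.injective hc)

theorem ciliatedVertices_eq_image (G : RibbonGraph) :
    G.ciliatedVertices = G.vertexOf '' G.cilia := rfl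

theorem ncard_ciliatedVertices {G : RibbonGraph} (hG : G.AtMostOneCiliumPerVertex) :
    G.ciliatedVertices.ncard = G.cilia.ncard := by
  rw [ciliatedVertices_eq_image]
  exact Set.InjOn.ncard_image fun c hc c' hc' h => hG c c' hc hc' h

theorem vertexOf_eq_iff (G : RibbonGraph) (h h' : G.H) :
    G.vertexOf h = G.vertexOf h' ↔ G.rot.SameCycle h h' :=
  Quotient.eq (r := Equiv.Perm.SameCycle.setoid G.rot)

theorem vertexOf_rot (G : RibbonGraph) (h : G.H) : G.vertexOf (G.rot h) = G.vertexOf h := by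
  rw [vertexOf_eq_iff, Equiv.Perm.sameCycle_apply_left]

/-- The face on the left of a half-edge. -/
def faceOf (G : RibbonGraph) (h : G.H) : G.Face :=
  Quotient.mk (Equiv.Perm.SameCycle.setoid G.faceStep) h

theorem faceOf_eq_iff (G : RibbonGraph) (h h' : G.H) :
    G.faceOf h = G.faceOf h' ↔ G.faceStep.SameCycle h h' :=
  Quotient.eq (r := Equiv.Perm.SameCycle.setoid G.faceStep)

theorem faceOf_faceStep (G : RibbonGraph) (h : G.H) : G.faceOf (G.faceStep h) = G.faceOf h := by
  rw [faceOf_eq_iff, Equiv.Perm.sameCycle_apply_left]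

namespace Iso

variable {G G' : RibbonGraph}

theorem connected (h : G.Iso G') (hG : G.Connected) : G'.Connected := by
  obtain ⟨e, hr, hf⟩ := h
  rw [connected_iff] at hG ⊢
  refine ⟨hG.1.map e, fun P h1 h2 h h' hP => ?_⟩
  have := hG.2 (fun x => P (e x)) (fun x => by rw [hr, h1]) (fun x => by rw [hf, h2])
    (e.symm h) (e.symm h')
  simpa [hP] using this

theorem ncard_cilia (h : G.Iso G') : G.cilia.ncard = G'.cilia.ncard := by
  obtain ⟨e, -, hf⟩ := h
  rw [← Set.ncard_image_of_injective _ e.injective]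
  congr 1
  ext x
  simp only [e.image_eq_preimage_symm, cilia, IsCilium, Set.mem_preimage, Set.mem_ofPred_eq]
  rw [← e.apply_eq_iff_eq, hf, e.apply_symm_apply]

theorem ncard_edges (h : G.Iso G') : G.edges.ncard = G'.edges.ncard := by
  obtain ⟨e, -, hf⟩ := h
  have h2 : {h | ¬ G.IsCilium h}.ncard = {h | ¬ G'.IsCilium h}.ncard := by
    rw [← Set.ncard_image_of_injective _ e.injective]
    congr 1
    ext x
    simp only [e.image_eq_preimage_symm, IsCilium, Set.mem_preimage, Set.mem_ofPred_eq]
    rw [← e.apply_eq_iff_eq, hf, e.apply_symm_apply]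
  rw [ncard_not_isCilium, ncard_not_isCilium] at h2
  omega

end Iso

end RibbonGraph

/-! ### The intermediate graph of an alternating graph. -/

namespace AltGraph

variable {G : AltGraph}

theorem prev_of_isLeg {o : G.Out} (h : G.IsLeg o.1) : G.prev o = o := by
  simp [prev, h]

theorem prev_val {o : G.Out} (h : ¬ G.IsLeg o.1) : (G.prev o).1 = G.flip (G.rot o.1) := by
  simp [prev, h]

theorem next_val {o : G.Out} (h : ¬ G.IsLeg (G.flip o.1)) :
    (G.next o).1 = G.rot.symm (G.flip o.1) := by
  simp [next, h]

theorem not_isLeg_next {o : G.Out} (h : ¬ G.IsLeg (G.flip o.1)) : ¬ G.IsLeg (G.next o).1 := by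
  rw [next_val h]
  exact G.not_isLeg_symm h

theorem prev_next {o : G.Out} (h : ¬ G.IsLeg (G.flip o.1)) : G.prev (G.next o) = o := by
  apply Subtype.ext
  rw [prev_val (not_isLeg_next h), next_val h]
  simp [G.flip_flip]

theorem blackSucc_of_isLeg {o : G.Out} (h : G.IsLeg (G.flip o.1)) :
    G.blackSucc o = G.prev^[Nat.card G.Out] o := by
  simp [blackSucc, h]

theorem blackSucc_of_not_isLeg {o : G.Out} (h : ¬ G.IsLeg (G.flip o.1)) :
    G.blackSucc o = G.next o := by
  simp [blackSucc, h]

theorem isLeg_blackSucc_iff {o : G.Out} :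
    G.IsLeg (G.blackSucc o).1 ↔ G.IsLeg (G.flip o.1) := by
  by_cases h : G.IsLeg (G.flip o.1)
  · simp only [h, iff_true, blackSucc_of_isLeg h]
    exact G.isLeg_prev_iterate h
  · simp only [h, iff_false, blackSucc_of_not_isLeg h]
    exact not_isLeg_next h

theorem blackSucc_prev {o : G.Out} (h : ¬ G.IsLeg o.1) : G.blackSucc (G.prev o) = o := by
  rw [blackSucc_of_not_isLeg (G.not_isLeg_flip_prev h), G.next_prev h]

theorem opposite_of_isLeg {o : G.Out} (h : G.IsLeg o.1) : G.opposite o = o := by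
  simp [opposite, h]

theorem opposite_val {o : G.Out} (h : ¬ G.IsLeg o.1) :
    (G.opposite o).1 = G.rot (G.rot o.1) := by
  simp [opposite, h]

theorem toIntermediate_isCilium_iff (o : G.Out) :
    G.toIntermediate.IsCilium o ↔ G.IsLeg o.1 := by
  refine ⟨fun h => ?_, opposite_of_isLeg⟩
  by_contra hl
  have h' := congrArg Subtype.val (show G.opposite o = o from h)
  rw [opposite_val hl] at h'
  exact apply_apply_ne_of_minimalPeriod_eq_four (G.valence _ hl).1 h'

theorem connected_toIntermediate : G.toIntermediate.Connected ↔ Nonempty G.Out ∧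
    ∀ P : G.Out → Prop, (∀ o, P (G.blackSucc o) ↔ P o) → (∀ o, P (G.opposite o) ↔ P o) →
      ∀ o o', P o → P o' :=
  G.toIntermediate.connected_iff

/-- A stable predicate on `G.H` restricts to `G.Out`; one on `G.Out` extends to `G.H` by giving both
ends of an edge the same value. -/
theorem toIntermediate_connected_iff : G.toIntermediate.Connected ↔ G.Connected := by
  rw [connected_toIntermediate, RibbonGraph.connected_iff]
  constructor
  · rintro ⟨⟨o⟩, hP⟩
    refine ⟨⟨o.1⟩, fun P hr hf h h' hh => ?_⟩
    have hs : ∀ x, P (G.rot.symm x) ↔ P x := fun x => by rw [← hr, Equiv.apply_symm_apply]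
    have hprev : ∀ o, P (G.prev o).1 ↔ P o.1 := fun o => by
      by_cases ho : G.IsLeg o.1
      · rw [prev_of_isLeg ho]
      · rw [prev_val ho, hf, hr]
    have hiter : ∀ k o, P (G.prev^[k] o).1 ↔ P o.1 := fun k => by
      induction k with
      | zero => exact fun o => Iff.rfl
      | succ k ih => exact fun o => (ih _).trans (hprev o)
    have hout : ∀ x, ∃ o : G.Out, P o.1 ↔ P x := fun x => by
      by_cases hx : G.out x
      · exact ⟨⟨x, hx⟩, Iff.rfl⟩
      · exact ⟨⟨G.flip x, (G.out_flip x).2 hx⟩, hf x⟩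
    obtain ⟨a, ha⟩ := hout h
    obtain ⟨b, hb⟩ := hout h'
    refine hb.1 (hP (fun o => P o.1) (fun o => ?_) (fun o => ?_) a b (ha.2 hh))
    · by_cases ho : G.IsLeg (G.flip o.1)
      · rw [blackSucc_of_isLeg ho, hiter]
      · rw [blackSucc_of_not_isLeg ho, next_val ho, hs, hf]
    · by_cases ho : G.IsLeg o.1
      · rw [opposite_of_isLeg ho]
      · rw [opposite_val ho, hr, hr]
  · rintro ⟨⟨h⟩, hP⟩
    have hne : Nonempty G.Out := by
      by_cases hx : G.out h
      · exact ⟨⟨h, hx⟩⟩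
      · exact ⟨⟨G.flip h, (G.out_flip h).2 hx⟩⟩
    refine ⟨hne, fun P hr hf a b hab => ?_⟩
    let P' : G.H → Prop := fun x => ∃ o : G.Out, P o ∧ (x = o.1 ∨ x = G.flip o.1)
    have hout : ∀ o : G.Out, P' o.1 ↔ P o := fun o => by
      refine ⟨?_, fun ho => ⟨o, ho, Or.inl rfl⟩⟩
      rintro ⟨o', h1, h2 | h2⟩
      · rwa [Subtype.ext h2]
      · have := o.2
        rw [h2, G.out_flip] at this
        exact absurd o'.2 this
    have hflip : ∀ x, P' (G.flip x) ↔ P' x := fun x => by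
      have h1 : ∀ y, P' y → P' (G.flip y) := by
        rintro y ⟨o, ho, rfl | rfl⟩
        · exact ⟨o, ho, Or.inr rfl⟩
        · exact ⟨o, ho, Or.inl (G.flip_flip _)⟩
      exact ⟨fun h => by simpa [G.flip_flip] using h1 _ h, h1 x⟩
    have hrot_out : ∀ x, ¬ G.IsLeg x → G.out x → (P' (G.rot x) ↔ P' x) := fun x hx ho => by
      rw [← hflip, ← prev_val (o := ⟨x, ho⟩) hx, hout, ← hr, blackSucc_prev (o := ⟨x, ho⟩) hx]
      exact (hout ⟨x, ho⟩).symm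
    refine (hout b).1 (hP P' (fun x => ?_) hflip _ _ ((hout a).2 hab))
    by_cases hx : G.IsLeg x
    · rw [show G.rot x = x from hx]
    by_cases ho : G.out x
    · exact hrot_out x hx ho
    · have hs := G.not_isLeg_symm hx
      have hso := (G.out_symm hx).2 ho
      have h1 := hrot_out _ hs hso
      rw [Equiv.apply_symm_apply] at h1
      have h2 := opposite_val (o := ⟨_, hso⟩) hs
      rw [Equiv.apply_symm_apply] at h2
      rw [h1, ← h2, hout, hf]
      exact (hout ⟨_, hso⟩).symm

/-- Going backwards along a black piece ends at a single source. The property "some iterate of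
`prev` arrives at `c`" is carried around the cycle of `c`, and `c'`, being a source, is fixed by
`prev`. -/
theorem toIntermediate_atMostOneCiliumPerVertex :
    G.toIntermediate.AtMostOneCiliumPerVertex := by
  intro (c : G.Out) (c' : G.Out) hc hc' hcc
  replace hcc := (G.toIntermediate.vertexOf_eq_iff c c').1 hcc
  replace hc := (toIntermediate_isCilium_iff c).1 hc
  replace hc' := (toIntermediate_isCilium_iff c').1 hc'
  have hfin := G.toIntermediate.finite_H
  have key : ∃ j, G.prev^[j] c' = c := by
    refine sameCycle_induction (P := fun x : G.Out => ∃ j, G.prev^[j] x = c) hcc ⟨0, rfl⟩ ?_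
    rintro (x : G.Out) ⟨j, hj⟩
    change ∃ j, G.prev^[j] (G.blackSucc x) = c
    by_cases hx : G.IsLeg (G.flip x.1)
    · refine ⟨0, ?_⟩
      -- Both `blackSucc x` and `c` are iterates of `prev` on `x` that `prev` fixes; as iterates
      -- commute, they coincide.
      have h1 : G.prev^[j] (G.blackSucc x) = G.blackSucc x :=
        Function.iterate_fixed (prev_of_isLeg (isLeg_blackSucc_iff.2 hx)) j
      rw [Function.iterate_zero, id, ← h1, blackSucc_of_isLeg hx, ← Function.iterate_add_apply,
        Nat.add_comm, Function.iterate_add_apply, hj, Function.iterate_fixed (prev_of_isLeg hc)]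
    · exact ⟨j + 1, by
        rw [Function.iterate_succ_apply, blackSucc_of_not_isLeg hx, prev_next hx, hj]⟩
  obtain ⟨j, hj⟩ := key
  rw [← hj, Function.iterate_fixed (prev_of_isLeg hc')]

theorem ncard_edges_toIntermediate :
    G.toIntermediate.edges.ncard = G.innerVertices.ncard := by
  have := G.finite_H
  have h1 := G.toIntermediate.ncard_not_isCilium
  have h2 : {h | ¬ G.toIntermediate.IsCilium h}.ncard = {h | G.out h ∧ ¬ G.IsLeg h}.ncard := by
    refine (Set.ncard_image_of_injective _ (Subtype.val_injective (p := G.out))).symm.trans ?_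
    congr 1
    ext x
    constructor
    · rintro ⟨o, ho, rfl⟩
      exact ⟨o.2, fun h => ho ((toIntermediate_isCilium_iff o).2 h)⟩
    · rintro ⟨ho, hl⟩
      exact ⟨⟨x, ho⟩, fun h => hl ((toIntermediate_isCilium_iff _).1 h), rfl⟩
  have h3 : G.innerVertices = G.vertexOf '' {h | G.out h ∧ ¬ G.IsLeg h} := by
    ext v
    constructor
    · rintro ⟨h, hl, rfl⟩
      by_cases ho : G.out h
      · exact ⟨h, ⟨ho, hl⟩, rfl⟩
      · exact ⟨G.rot h, ⟨(G.valence h hl).2.2 ho, G.not_isLeg_rot hl⟩, G.vertexOf_rot h⟩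
    · rintro ⟨h, ⟨-, hl⟩, rfl⟩
      exact ⟨h, hl, rfl⟩
  -- By alternation, the outgoing half-edges at the vertex of `a` are exactly `a` and `rot (rot a)`.
  have h4 : {h | G.out h ∧ ¬ G.IsLeg h}.ncard = 2 * G.innerVertices.ncard := by
    rw [h3]
    refine ncard_eq_two_mul_ncard_image _ _ (fun h => G.rot (G.rot h))
      (fun a ha => apply_apply_ne_of_minimalPeriod_eq_four (G.valence a ha.2).1) ?_
    rintro a ⟨ha, hl⟩ x
    have hl1 := G.not_isLeg_rot hl
    have hl2 := G.not_isLeg_rot hl1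
    have o1 := (G.valence a hl).2
    have o2 := (G.valence _ hl1).2
    have o3 := (G.valence _ hl2).2
    rw [G.vertexOf_eq_iff, sameCycle_iff_of_iterate_four (G.valence a hl).1]
    constructor
    · rintro ⟨⟨hx, -⟩, (rfl | rfl | rfl | rfl)⟩ <;> tauto
    · rintro (rfl | rfl)
      · exact ⟨⟨ha, hl⟩, Or.inl rfl⟩
      · exact ⟨⟨by tauto, hl2⟩, by tauto⟩
  omega

/-- `blackSucc` maps the half-edges leading to sinks bijectively onto the sources, so sinks and
sources are equally many, and the sources are the cilia. -/
theorem ncard_legs : G.legs.ncard = 2 * G.toIntermediate.ciliatedVertices.ncard := by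
  have := G.finite_H
  rw [RibbonGraph.ncard_ciliatedVertices toIntermediate_atMostOneCiliumPerVertex]
  have hS : G.toIntermediate.cilia = {o : G.Out | G.IsLeg o.1} :=
    Set.ext toIntermediate_isCilium_iff
  have hT : {o : G.Out | G.IsLeg o.1} = G.blackSucc '' {o : G.Out | G.IsLeg (G.flip o.1)} := by
    ext o
    obtain ⟨o, rfl⟩ := (Finite.injective_iff_surjective.1 G.blackSucc_injective) o
    rw [G.blackSucc_injective.mem_set_image]
    exact isLeg_blackSucc_iff
  have hU : G.legs = Subtype.val '' {o : G.Out | G.IsLeg o.1} ∪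
      (fun o : G.Out => G.flip o.1) '' {o : G.Out | G.IsLeg (G.flip o.1)} := by
    ext x
    constructor
    · intro hx
      by_cases ho : G.out x
      · exact Or.inl ⟨⟨x, ho⟩, hx, rfl⟩
      · refine Or.inr ⟨⟨G.flip x, (G.out_flip x).2 ho⟩, ?_, G.flip_flip x⟩
        rwa [Set.mem_ofPred_eq, G.flip_flip]
    · rintro (⟨o, ho, rfl⟩ | ⟨o, ho, rfl⟩) <;> exact ho
  rw [hU, Set.ncard_union_eq, Set.ncard_image_of_injective _ Subtype.val_injective,
    Set.ncard_image_of_injective (f := fun o : G.Out => G.flip o.1) _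
      (G.flip.injective.comp Subtype.val_injective), hS]
  · have h1 := Set.ncard_image_of_injective {o : G.Out | G.IsLeg (G.flip o.1)}
      G.blackSucc_injective
    rw [← hT] at h1
    rw [← h1, ← two_mul]
    rfl
  · rw [Set.disjoint_left]
    rintro _ ⟨o, -, rfl⟩ ⟨o', -, h⟩
    have := o.2
    rw [← h] at this
    exact (G.out_flip _).1 this o'.2

theorem toIntermediate_iso {G' : AltGraph} (h : G.Iso G') :
    G.toIntermediate.Iso G'.toIntermediate := by
  obtain ⟨e, hr, hf, ho⟩ := h
  let e' : G.Out ≃ G'.Out := e.subtypeEquiv fun a => (ho a).symm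
  have hv : ∀ o, (e' o).1 = e o.1 := fun o => rfl
  have hs : ∀ x, e (G.rot.symm x) = G'.rot.symm (e x) := fun x => by
    rw [Equiv.eq_symm_apply, ← hr, Equiv.apply_symm_apply]
  have hl : ∀ x, G'.IsLeg (e x) ↔ G.IsLeg x := fun x => by
    rw [IsLeg, IsLeg, ← hr, e.apply_eq_iff_eq]
  have hprev : ∀ o, e' (G.prev o) = G'.prev (e' o) := fun o => by
    by_cases h : G.IsLeg o.1
    · rw [prev_of_isLeg h, prev_of_isLeg ((hl _).2 h)]
    · apply Subtype.ext
      rw [hv, prev_val h, prev_val (o := e' o) (mt (hl _).1 h), hf, hr, hv]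
  have hiter : ∀ k o, e' (G.prev^[k] o) = G'.prev^[k] (e' o) := fun k => by
    induction k with
    | zero => exact fun o => rfl
    | succ k ih => exact fun o => by rw [Function.iterate_succ_apply, ih, hprev]; rfl
  refine ⟨e', fun (o : G.Out) => ?_, fun (o : G.Out) => ?_⟩
  · change e' (G.blackSucc o) = G'.blackSucc (e' o)
    have hl' : G'.IsLeg (G'.flip (e' o).1) ↔ G.IsLeg (G.flip o.1) := by rw [hv, ← hf, hl]
    by_cases h : G.IsLeg (G.flip o.1)
    · rw [blackSucc_of_isLeg h, blackSucc_of_isLeg (hl'.2 h), hiter, Nat.card_congr e']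
    · apply Subtype.ext
      rw [blackSucc_of_not_isLeg h, blackSucc_of_not_isLeg (mt hl'.1 h), hv, next_val h,
        next_val (mt hl'.1 h), hs, hf, hv]
  · change e' (G.opposite o) = G'.opposite (e' o)
    by_cases h : G.IsLeg o.1
    · rw [opposite_of_isLeg h, opposite_of_isLeg ((hl _).2 h)]
    · apply Subtype.ext
      rw [hv, opposite_val h, opposite_val (o := e' o) (mt (hl _).1 h), hr, hr, hv]

theorem expand_toIntermediate_iso : G.toIntermediate.expand.Iso G := by
  let R : Equiv.Perm G.Out := G.toIntermediate.rot
  have hR : ∀ o, R o = G.blackSucc o := fun o => rfl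
  have hRs : ∀ o, ¬ G.IsLeg o.1 → R.symm o = G.prev o := fun o h => by
    rw [Equiv.symm_apply_eq, hR, blackSucc_prev h]
  -- `(o, false)` is the arriving end of the edge that precedes `o` on its black boundary. If `o` is
  -- a source, `R.symm o` leads to the sink of the same piece, so `(o, false)` becomes that sink.
  let f : G.Out × Bool → G.H := fun x => if x.2 then x.1.1 else G.flip (R.symm x.1).1
  have ft : ∀ o, f (o, true) = o.1 := fun o => rfl
  have ff : ∀ o, f (o, false) = G.flip (R.symm o).1 := fun o => rfl
  have hout : ∀ x, G.out (f x) ↔ x.2 = true := by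
    rintro ⟨o, _ | _⟩
    · simp [ff, G.out_flip, (R.symm o).2]
    · simp [ft, o.2]
  have hbij : Function.Bijective f := by
    constructor
    · rintro ⟨o, b⟩ ⟨o', b'⟩ h
      have hb : b = b' := by
        have h1 := hout (o, b)
        have h2 := hout (o', b')
        rw [h, h2] at h1
        exact (Bool.eq_iff_iff.2 h1).symm
      subst hb
      cases b
      · rw [ff, ff] at h
        rw [R.symm.injective (Subtype.ext (G.flip.injective h))]
      · rw [ft, ft] at h
        rw [Subtype.ext h]
    · intro x
      by_cases hx : G.out x
      · exact ⟨(⟨x, hx⟩, true), rfl⟩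
      · exact ⟨(R ⟨G.flip x, (G.out_flip x).2 hx⟩, false), by
          rw [ff, Equiv.symm_apply_apply, G.flip_flip]⟩
  refine ⟨Equiv.ofBijective f hbij, ?_, ?_, hout⟩
  · rintro ⟨(o : G.Out), b⟩
    change f (G.toIntermediate.expandRot (o, b)) = G.rot (f (o, b))
    by_cases hc : G.IsLeg o.1
    · have h1 : G.toIntermediate.expandRot (o, b) = (o, b) :=
        if_pos ((toIntermediate_isCilium_iff o).2 hc)
      rw [h1]
      cases b
      · have h2 : G.IsLeg (G.flip (R.symm o).1) := by
          rwa [← isLeg_blackSucc_iff, ← hR, Equiv.apply_symm_apply]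
        exact h2.symm
      · exact hc.symm
    · have h1 : G.toIntermediate.expandRot (o, b) = if b then (o, false) else (G.opposite o, true) :=
        if_neg (mt (toIntermediate_isCilium_iff o).1 hc)
      rw [h1]
      cases b
      · change (G.opposite o).1 = G.rot (G.flip (R.symm o).1)
        rw [opposite_val hc, hRs o hc, prev_val hc, G.flip_flip]
      · change G.flip (R.symm o).1 = G.rot o.1
        rw [hRs o hc, prev_val hc, G.flip_flip]
  · rintro ⟨(o : G.Out), _ | _⟩
    · change (R.symm o).1 = G.flip (G.flip (R.symm o).1)
      rw [G.flip_flip]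
    · change G.flip (R.symm (R o)).1 = G.flip o.1
      rw [Equiv.symm_apply_apply]

end AltGraph

/-! ### Expansion as the inverse construction. -/

namespace RibbonGraph

theorem expand_isLeg_iff (A : RibbonGraph) (x : A.H × Bool) :
    A.expand.IsLeg x ↔ A.IsCilium x.1 := by
  refine ⟨fun h => ?_, fun h => if_pos h⟩
  by_contra hc
  have h1 : A.expandRot x = if x.2 then (x.1, false) else (A.flip x.1, true) := if_neg hc
  have h2 : A.expandRot x = x := h
  rw [h1] at h2
  obtain ⟨a, _ | _⟩ := x <;> simp at h2

theorem toIntermediate_expand_iso {A : RibbonGraph} (hA : A.AtMostOneCiliumPerVertex) :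
    A.expand.toIntermediate.Iso A := by
  have := A.finite_H
  let e : A.expand.Out ≃ A.H :=
    { toFun := fun o => o.1.1
      invFun := fun h => ⟨(h, true), rfl⟩
      left_inv := by rintro ⟨⟨h, b⟩, hb⟩; exact Subtype.ext (Prod.ext rfl hb.symm)
      right_inv := fun h => rfl }
  have hrot : ∀ o : A.expand.Out, ¬ A.IsCilium o.1.1 →
      A.expand.rot o.1 = (o.1.1, false) := by
    rintro ⟨⟨h, b⟩, hb⟩ hc
    cases (show b = true from hb)
    exact if_neg hc
  have hrots : ∀ h : A.H, ¬ A.IsCilium h → A.expand.rot.symm (h, false) = (h, true) := by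
    intro h hc
    refine A.expand.rot.symm_apply_eq.2 ?_
    exact (hrot ⟨(h, true), rfl⟩ hc).symm
  have hflip : ∀ o : A.expand.Out, A.expand.flip o.1 = (A.rot o.1.1, false) := by
    rintro ⟨⟨h, b⟩, hb⟩
    cases (show b = true from hb)
    rfl
  have hprev : ∀ o : A.expand.Out, A.rot.SameCycle (A.expand.prev o).1.1 o.1.1 := by
    intro o
    by_cases h : A.expand.IsLeg o.1
    · rw [AltGraph.prev_of_isLeg h]
    · rw [AltGraph.prev_val h, hrot o (mt (A.expand_isLeg_iff o.1).2 h)]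
      change A.rot.SameCycle (A.rot.symm o.1.1) o.1.1
      exact Equiv.Perm.sameCycle_symm_apply_left.2 (Equiv.Perm.SameCycle.refl _ _)
  have hiter : ∀ k (o : A.expand.Out), A.rot.SameCycle (A.expand.prev^[k] o).1.1 o.1.1 := by
    intro k
    induction k with
    | zero => exact fun o => Equiv.Perm.SameCycle.refl _ _
    | succ k ih => exact fun o => (ih _).trans (hprev o)
  refine ⟨e, fun (o : A.expand.Out) => ?_, fun (o : A.expand.Out) => ?_⟩
  · change (A.expand.blackSucc o).1.1 = A.rot o.1.1
    have hl : A.expand.IsLeg (A.expand.flip o.1) ↔ A.IsCilium (A.rot o.1.1) := by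
      rw [hflip, expand_isLeg_iff]
    by_cases h : A.expand.IsLeg (A.expand.flip o.1)
    -- At a sink, `blackSucc` returns to some source reached by `prev`, which never leaves the
    -- vertex of `A`. This source and `A.rot` of the current half-edge are cilia at the same vertex,
    -- so uniqueness identifies them.
    · refine hA _ _ ((A.expand_isLeg_iff _).1 (AltGraph.isLeg_blackSucc_iff.2 h)) (hl.1 h) ?_
      rw [vertexOf_rot, vertexOf_eq_iff, AltGraph.blackSucc_of_isLeg h]
      exact hiter _ _
    · rw [AltGraph.blackSucc_of_not_isLeg h, AltGraph.next_val h, hflip, hrots _ (mt hl.2 h)]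
  · change (A.expand.opposite o).1.1 = A.flip o.1.1
    by_cases h : A.IsCilium o.1.1
    · rw [AltGraph.opposite_of_isLeg ((A.expand_isLeg_iff _).2 h)]
      exact h.symm
    · rw [AltGraph.opposite_val (mt (A.expand_isLeg_iff _).1 h), hrot o h]
      exact congrArg Prod.fst (if_neg h : A.expandRot (o.1.1, false) = _)

theorem expand_iso {A A' : RibbonGraph} (h : A.Iso A') : A.expand.Iso A'.expand := by
  obtain ⟨e, hr, hf⟩ := h
  have hs : ∀ x, e (A.rot.symm x) = A'.rot.symm (e x) := fun x => by
    rw [Equiv.eq_symm_apply, ← hr, Equiv.apply_symm_apply]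
  have hc : ∀ x, A'.IsCilium (e x) ↔ A.IsCilium x := fun x => by
    rw [IsCilium, IsCilium, ← hf, e.apply_eq_iff_eq]
  refine ⟨e.prodCongr (Equiv.refl Bool), ?_, ?_, fun x => Iff.rfl⟩
  · rintro ⟨h, b⟩
    change (e.prodCongr (Equiv.refl Bool)) (A.expandRot (h, b)) = A'.expandRot (e h, b)
    by_cases k : A.IsCilium h
    · rw [show A.expandRot (h, b) = (h, b) from if_pos k,
        show A'.expandRot (e h, b) = (e h, b) from if_pos ((hc h).2 k)]
      rfl
    · rw [show A.expandRot (h, b) = if b then (h, false) else (A.flip h, true) from if_neg k,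
        show A'.expandRot (e h, b) = if b then (e h, false) else (A'.flip (e h), true) from
          if_neg (mt (hc h).1 k)]
      cases b <;> simp [hf]
  · rintro ⟨h, _ | _⟩
    · exact Prod.ext (hs h) rfl
    · exact Prod.ext (hr h) rfl

end RibbonGraph

/-! ### Maps between cycles, invariance of the genus, and separated cilia. -/

theorem SameCycle.map {α β : Type*} [Finite α] {σ : Equiv.Perm α} {τ : Equiv.Perm β} {f : α → β}
    (hf : ∀ x, τ.SameCycle (f (σ x)) (f x)) {a b : α} (h : σ.SameCycle a b) :
    τ.SameCycle (f a) (f b) :=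
  sameCycle_induction (P := fun x => τ.SameCycle (f a) (f x)) h (Equiv.Perm.SameCycle.refl _ _)
    fun x hx => hx.trans (hf x).symm

theorem eq_of_sameCycle {α β : Type*} [Finite α] {σ : Equiv.Perm α} {f : α → β}
    (hf : ∀ x, f (σ x) = f x) {a b : α} (h : σ.SameCycle a b) : f a = f b :=
  sameCycle_induction (P := fun x => f a = f x) h rfl fun x hx => hx.trans (hf x).symm

theorem card_quotient_sameCycle_congr {α β : Type} [Finite α] {σ : Equiv.Perm α}
    {τ : Equiv.Perm β} (e : α ≃ β) (he : ∀ x, e (σ x) = τ (e x)) :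
    Nat.card (Quotient (Equiv.Perm.SameCycle.setoid σ)) =
      Nat.card (Quotient (Equiv.Perm.SameCycle.setoid τ)) := by
  have : Finite β := Finite.of_equiv α e
  refine Nat.card_congr (Quotient.congr e fun a b => ⟨?_, fun h => ?_⟩)
  · refine SameCycle.map fun x => ?_
    rw [he, Equiv.Perm.sameCycle_apply_left]
  · have h2 := SameCycle.map (σ := τ) (τ := σ) (f := e.symm) (fun x => by
      rw [show e.symm (τ x) = σ (e.symm x) by rw [e.symm_apply_eq, he, e.apply_symm_apply],
        Equiv.Perm.sameCycle_apply_left]) h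
    rwa [e.symm_apply_apply, e.symm_apply_apply] at h2

namespace RibbonGraph

instance (G : RibbonGraph) : Finite G.Vertex :=
  have := G.finite_H
  inferInstanceAs (Finite (Quotient _))

instance (G : RibbonGraph) : Finite G.Face :=
  have := G.finite_H
  inferInstanceAs (Finite (Quotient _))

theorem Iso.hasGenus {G G' : RibbonGraph} (h : G.Iso G') {g : ℕ} (hG : G.HasGenus g) :
    G'.HasGenus g := by
  have h1 := h.ncard_edges
  obtain ⟨e, hr, hf⟩ := h
  have := G.finite_H
  have hV : Nat.card G.Vertex = Nat.card G'.Vertex := card_quotient_sameCycle_congr e hr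
  have hF : Nat.card G.Face = Nat.card G'.Face := by
    refine card_quotient_sameCycle_congr e fun x => ?_
    change e (G.rot.symm (G.flip x)) = G'.rot.symm (G'.flip (e x))
    rw [Equiv.eq_symm_apply, ← hr, Equiv.apply_symm_apply, hf]
  rw [HasGenus] at hG ⊢
  rw [← h1, ← hV, ← hF, hG]

/-- The corner condition still allows a cilium alone at its vertex, its own successor. Such a cilium
is a whole connected component, which the presence of an edge excludes. -/
theorem not_isCilium_rot {A : RibbonGraph} (hc : A.Connected)
    (hA : A.AtMostOneCiliumPerCorner) (he : 0 < A.edges.ncard) {c : A.H} (h : A.IsCilium c) :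
    ¬ A.IsCilium (A.rot c) := by
  intro h'
  have hr := hA c h h'
  have hall := ((A.connected_iff).1 hc).2 (fun x => x = c)
    (fun x => by rw [← A.rot.apply_eq_iff_eq (x := x), hr])
    (fun x => by rw [← A.flip.apply_eq_iff_eq (x := x), show A.flip c = c from h])
  have hempty : A.edges = ∅ := by
    rw [Set.eq_empty_iff_forall_notMem]
    rintro _ ⟨x, hx, -⟩
    rw [hall c x rfl] at hx
    exact hx h
  rw [hempty, Set.ncard_empty] at he
  exact lt_irrefl _ he

end RibbonGraph

/-! ### The intermediate graph of a quadrangulation. -/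

namespace MarkedQuadrangulation

variable (Q : MarkedQuadrangulation)

/-- Half-edges at black vertices. -/
abbrev Black : Type := {d : Q.H // Q.black d}

abbrev Corner : Type := Q.Black ⊕ {d : Q.H // Q.black d ∧ Q.marked d}

def rotBlack : Equiv.Perm Q.Black :=
  Q.rot.subtypePerm Q.black_rot

/-- The other black corner of a face. -/
def opp (d : Q.Black) : Q.Black :=
  ⟨Q.faceStep (Q.faceStep d.1), by rw [Q.black_faceStep, Q.black_faceStep, not_not]; exact d.2⟩

variable {Q}

theorem rotBlack_val (d : Q.Black) : (Q.rotBlack d).1 = Q.rot d.1 := rfl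

theorem rotBlack_symm_val (d : Q.Black) : (Q.rotBlack.symm d).1 = Q.rot.symm d.1 := by
  rw [Equiv.eq_symm_apply, ← rotBlack_val, Equiv.apply_symm_apply]

theorem opp_val (d : Q.Black) : (Q.opp d).1 = Q.faceStep (Q.faceStep d.1) := rfl

theorem faceStep_apply (h : Q.H) : Q.faceStep h = Q.rot.symm (Q.flip h) := rfl

theorem rot_faceStep (h : Q.H) : Q.rot (Q.faceStep h) = Q.flip h :=
  Equiv.apply_symm_apply _ _

theorem faceStep_flip (h : Q.H) : Q.faceStep (Q.flip h) = Q.rot.symm h := by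
  rw [faceStep_apply, Q.flip_flip]

theorem faceStep_flip_rot (h : Q.H) : Q.faceStep (Q.flip (Q.rot h)) = h := by
  rw [faceStep_flip, Equiv.symm_apply_apply]

theorem faceStep_four (h : Q.H) :
    Q.faceStep (Q.faceStep (Q.faceStep (Q.faceStep h))) = h := by
  have h4 := Function.isPeriodicPt_minimalPeriod Q.faceStep h
  rw [show Function.minimalPeriod Q.faceStep h = 4 from Q.face_degree h] at h4
  exact h4

theorem faceStep_three (h : Q.H) :
    Q.faceStep (Q.faceStep (Q.faceStep h)) = Q.flip (Q.rot h) := by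
  rw [← Q.faceStep.apply_eq_iff_eq, faceStep_four, faceStep_flip_rot]

theorem faceStep_faceStep_ne (h : Q.H) : Q.faceStep (Q.faceStep h) ≠ h :=
  apply_apply_ne_of_minimalPeriod_eq_four (Q.face_degree h)

/-- The rotation around white vertices, expressed with black half-edges. -/
theorem rot_flip (h : Q.H) :
    Q.rot (Q.flip h) = Q.flip (Q.faceStep (Q.faceStep (Q.rot.symm h))) := by
  rw [← rot_faceStep (Q.faceStep _), faceStep_three, Equiv.apply_symm_apply]

theorem blackRot_inl_of_marked {d : Q.Black} (h : Q.marked (Q.rot d.1)) :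
    Q.blackRot (Sum.inl d) = Sum.inr ⟨Q.rot d.1, (Q.rotBlack d).2, h⟩ :=
  dif_pos h

theorem blackRot_inl_of_not_marked {d : Q.Black} (h : ¬ Q.marked (Q.rot d.1)) :
    Q.blackRot (Sum.inl d) = Sum.inl (Q.rotBlack d) :=
  dif_neg h

theorem blackRot_inr (d : {d : Q.H // Q.black d ∧ Q.marked d}) :
    Q.blackRot (Sum.inr d) = Sum.inl ⟨d.1, d.2.1⟩ := rfl

theorem blackFlip_inl (d : Q.Black) : Q.blackFlip (Sum.inl d) = Sum.inl (Q.opp d) := rfl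

theorem isCilium_inr (d : {d : Q.H // Q.black d ∧ Q.marked d}) :
    Q.toIntermediate.IsCilium (Sum.inr d : Q.Corner) := rfl

theorem not_isCilium_inl (d : Q.Black) : ¬ Q.toIntermediate.IsCilium (Sum.inl d : Q.Corner) := by
  intro h
  exact faceStep_faceStep_ne d.1
    (congrArg Subtype.val (Sum.inl.inj (show Q.blackFlip (Sum.inl d) = Sum.inl d from h)))

theorem connected_toIntermediate : Q.toIntermediate.Connected ↔ Nonempty Q.Corner ∧
    ∀ P : Q.Corner → Prop, (∀ x, P (Q.blackRot x) ↔ P x) → (∀ x, P (Q.blackFlip x) ↔ P x) →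
      ∀ x x', P x → P x' :=
  Q.toIntermediate.connected_iff

theorem eq_black_or_eq_flip_black (h : Q.H) : ∃ d : Q.Black, h = d.1 ∨ h = Q.flip d.1 := by
  by_cases hb : Q.black h
  · exact ⟨⟨h, hb⟩, Or.inl rfl⟩
  · exact ⟨⟨Q.flip h, (Q.black_flip h).2 hb⟩, Or.inr (Q.flip_flip h).symm⟩

/-- Stable predicates are again extended along edges from black half-edges; stability around white
vertices comes from `rot_flip`. -/
theorem toIntermediate_connected_iff : Q.toIntermediate.Connected ↔ Q.Connected := by
  rw [connected_toIntermediate, RibbonGraph.connected_iff]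
  constructor
  · rintro ⟨⟨x⟩, hP⟩
    refine ⟨⟨Sum.elim (fun d => d.1) (fun d => d.1) x⟩, fun P hr hf h h' hh => ?_⟩
    have hs : ∀ x, P (Q.rot.symm x) ↔ P x := fun x => by rw [← hr, Equiv.apply_symm_apply]
    obtain ⟨a, ha⟩ : ∃ d : Q.Black, P d.1 ↔ P h := by
      obtain ⟨d, rfl | rfl⟩ := eq_black_or_eq_flip_black h
      exacts [⟨d, Iff.rfl⟩, ⟨d, (hf _).symm⟩]
    obtain ⟨b, hb⟩ : ∃ d : Q.Black, P d.1 ↔ P h' := by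
      obtain ⟨d, rfl | rfl⟩ := eq_black_or_eq_flip_black h'
      exacts [⟨d, Iff.rfl⟩, ⟨d, (hf _).symm⟩]
    refine hb.1 (hP (Sum.elim (fun d => P d.1) (fun d => P d.1)) ?_ ?_ (Sum.inl a) (Sum.inl b)
      (ha.2 hh))
    · rintro (d | d)
      · by_cases h : Q.marked (Q.rot d.1)
        · rw [blackRot_inl_of_marked h]
          exact hr _
        · rw [blackRot_inl_of_not_marked h]
          exact hr _
      · exact Iff.rfl
    · rintro (d | d)
      · rw [blackFlip_inl]
        change P (Q.opp d).1 ↔ P d.1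
        rw [opp_val, faceStep_apply, hs, hf, faceStep_apply, hs, hf]
      · exact Iff.rfl
  · rintro ⟨⟨h⟩, hP⟩
    obtain ⟨d, -⟩ := eq_black_or_eq_flip_black h
    refine ⟨⟨Sum.inl d⟩, fun P hr hf x x' hx => ?_⟩
    have hrot : ∀ d, P (Sum.inl (Q.rotBlack d)) ↔ P (Sum.inl d) := fun d => by
      by_cases h : Q.marked (Q.rot d.1)
      · rw [← hr (Sum.inl d), blackRot_inl_of_marked h, ← hr (Sum.inr _), blackRot_inr]
        rfl
      · rw [← hr (Sum.inl d), blackRot_inl_of_not_marked h]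
    have hrots : ∀ d, P (Sum.inl (Q.rotBlack.symm d)) ↔ P (Sum.inl d) := fun d => by
      rw [← hrot, Equiv.apply_symm_apply]
    have hopp : ∀ d, P (Sum.inl (Q.opp d)) ↔ P (Sum.inl d) := fun d => hf (Sum.inl d)
    let P' : Q.H → Prop := fun h => ∃ d : Q.Black, P (Sum.inl d) ∧ (h = d.1 ∨ h = Q.flip d.1)
    have hblack : ∀ d : Q.Black, P' d.1 ↔ P (Sum.inl d) := fun d => by
      refine ⟨?_, fun hd => ⟨d, hd, Or.inl rfl⟩⟩
      rintro ⟨d', h1, h2 | h2⟩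
      · rwa [Subtype.ext h2]
      · have := d.2
        rw [h2, Q.black_flip] at this
        exact absurd d'.2 this
    have hflip : ∀ x, P' (Q.flip x) ↔ P' x := fun x => by
      have h1 : ∀ y, P' y → P' (Q.flip y) := by
        rintro y ⟨o, ho, rfl | rfl⟩
        · exact ⟨o, ho, Or.inr rfl⟩
        · exact ⟨o, ho, Or.inl (Q.flip_flip _)⟩
      exact ⟨fun h => by simpa [Q.flip_flip] using h1 _ h, h1 x⟩
    have hP' := hP P' (fun h => ?_) hflip
    · have key : ∀ x, ∃ d, P (Sum.inl d) ↔ P x := by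
        rintro (d | d)
        · exact ⟨d, Iff.rfl⟩
        · exact ⟨_, hr (Sum.inr d)⟩
      obtain ⟨a, ha⟩ := key x
      obtain ⟨b, hb⟩ := key x'
      exact hb.1 ((hblack b).1 (hP' _ _ ((hblack a).2 (ha.2 hx))))
    · obtain ⟨d, rfl | rfl⟩ := eq_black_or_eq_flip_black h
      · rw [← rotBlack_val, hblack, hblack, hrot]
      · rw [rot_flip, hflip, hflip, ← rotBlack_symm_val, ← opp_val, hblack, hblack, hopp, hrots]

theorem toIntermediate_atMostOneCiliumPerCorner :
    Q.toIntermediate.AtMostOneCiliumPerCorner := by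
  rintro (d | d) h h'
  · exact absurd h (not_isCilium_inl d)
  · exact absurd h' (not_isCilium_inl ⟨d.1, d.2.1⟩)

/-- Black half-edges are the common measure for counting: two per edge of the intermediate graph,
one per edge of `Q`, two per face of `Q`. -/
theorem ncard_black : {h | Q.black h}.ncard = 2 * Q.toIntermediate.edges.ncard := by
  rw [← Q.toIntermediate.ncard_not_isCilium]
  have h : {h | ¬ Q.toIntermediate.IsCilium h} = Set.range (Sum.inl : Q.Black → Q.Corner) := by
    ext x
    obtain d | d := x
    · exact iff_of_true (not_isCilium_inl d) ⟨d, rfl⟩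
    · exact iff_of_false (fun h => h (isCilium_inr d)) (by rintro ⟨_, h⟩; cases h)
  rw [h, ← Set.image_univ]
  refine Eq.trans ?_ (Set.ncard_image_of_injective _ Sum.inl_injective).symm
  rw [Set.ncard_univ]
  rfl

theorem ncard_black_eq_ncard_edges : {h | Q.black h}.ncard = Q.edges.ncard := by
  have h : Q.edges = (fun h => ({h, Q.flip h} : Set Q.H)) '' {h | Q.black h} := by
    ext e
    constructor
    · rintro ⟨h, -, rfl⟩
      by_cases hb : Q.black h
      · exact ⟨h, hb, rfl⟩
      · exact ⟨Q.flip h, (Q.black_flip h).2 hb,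
          (Q.pair_flip_eq_iff h (Q.flip h)).2 (Or.inr rfl)⟩
    · rintro ⟨h, -, rfl⟩
      exact ⟨h, Q.flip_ne h, rfl⟩
  rw [h, Set.InjOn.ncard_image]
  intro a ha b hb hab
  obtain h | h := (Q.pair_flip_eq_iff b a).1 hab
  · exact h
  · exact absurd hb ((Q.black_flip b).1 (h ▸ ha))

theorem ncard_black_eq_two_mul_card_face :
    {h | Q.black h}.ncard = 2 * Nat.card Q.toRibbonGraph.Face := by
  have := Q.finite_H
  have hface : Q.faceOf '' {h | Q.black h} = Set.univ := by
    rw [Set.eq_univ_iff_forall]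
    rintro ⟨h⟩
    by_cases hb : Q.black h
    · exact ⟨h, hb, rfl⟩
    · exact ⟨Q.faceStep h, (Q.black_faceStep h).2 hb, Q.faceOf_faceStep h⟩
  rw [← Set.ncard_univ, ← hface]
  refine ncard_eq_two_mul_ncard_image _ _ (fun h => Q.faceStep (Q.faceStep h))
    (fun a _ => faceStep_faceStep_ne a) fun a (ha : Q.black a) x => ?_
  rw [Q.faceOf_eq_iff, sameCycle_iff_of_iterate_four (σ := Q.faceStep) (Q.face_degree a)]
  have h1 := Q.black_faceStep a
  have h2 := Q.black_faceStep (Q.faceStep a)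
  have h3 := Q.black_faceStep (Q.faceStep (Q.faceStep a))
  constructor
  · rintro ⟨hx : Q.black x, (rfl | rfl | rfl | rfl)⟩ <;> tauto
  · rintro (rfl | rfl)
    · exact ⟨ha, Or.inl rfl⟩
    · exact ⟨by change Q.black _; tauto, by tauto⟩

theorem card_face : Nat.card Q.toRibbonGraph.Face = Q.toIntermediate.edges.ncard := by
  have h1 := Q.ncard_black
  have h2 := Q.ncard_black_eq_two_mul_card_face
  omega

theorem ncard_markedEdges : Q.markedEdges.ncard = Q.toIntermediate.cilia.ncard := by
  have h : Q.markedEdges =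
      (fun h => ({h, Q.flip h} : Set Q.H)) '' {h | Q.black h ∧ Q.marked h} := by
    ext e
    constructor
    · rintro ⟨h, hm, rfl⟩
      by_cases hb : Q.black h
      · exact ⟨h, ⟨hb, hm⟩, rfl⟩
      · exact ⟨Q.flip h, ⟨(Q.black_flip h).2 hb, (Q.marked_flip h).2 hm⟩,
          (Q.pair_flip_eq_iff h (Q.flip h)).2 (Or.inr rfl)⟩
    · rintro ⟨h, hm, rfl⟩
      exact ⟨h, hm.2, rfl⟩
  have h' : Q.toIntermediate.cilia =
      Set.range (Sum.inr : {d : Q.H // Q.black d ∧ Q.marked d} → Q.Corner) := by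
    ext x
    obtain d | d := x
    · exact iff_of_false (not_isCilium_inl d) (by rintro ⟨_, h⟩; cases h)
    · exact iff_of_true (isCilium_inr d) ⟨d, rfl⟩
  rw [h', ← Set.image_univ]
  refine Eq.trans ?_ (Set.ncard_image_of_injective _ Sum.inr_injective).symm
  rw [Set.ncard_univ, h, Set.InjOn.ncard_image]
  · rfl
  · intro a ha b hb hab
    obtain h | h := (Q.pair_flip_eq_iff b a).1 hab
    · exact h
    · exact absurd hb.1 ((Q.black_flip b).1 (h ▸ ha.1))

theorem vertexOf_inr (d : {d : Q.H // Q.black d ∧ Q.marked d}) :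
    Q.toIntermediate.vertexOf (Sum.inl ⟨d.1, d.2.1⟩ : Q.Corner) =
      Q.toIntermediate.vertexOf (Sum.inr d : Q.Corner) :=
  Q.toIntermediate.vertexOf_rot (Sum.inr d : Q.Corner)

theorem vertexOf_rotBlack (d : Q.Black) :
    Q.toIntermediate.vertexOf (Sum.inl (Q.rotBlack d) : Q.Corner) =
      Q.toIntermediate.vertexOf (Sum.inl d : Q.Corner) := by
  have h1 := Q.toIntermediate.vertexOf_rot (Sum.inl d : Q.Corner)
  rw [← h1]
  change _ = Q.toIntermediate.vertexOf (Q.blackRot (Sum.inl d))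
  by_cases h : Q.marked (Q.rot d.1)
  · rw [blackRot_inl_of_marked h, ← vertexOf_inr]
    rfl
  · rw [blackRot_inl_of_not_marked h]

theorem blackRot_symm_inl_of_marked {d : Q.Black} (h : Q.marked d.1) :
    Q.blackRot.symm (Sum.inl d) = Sum.inr ⟨d.1, d.2, h⟩ := by
  rw [Equiv.symm_apply_eq, blackRot_inr]

theorem blackRot_symm_inl_of_not_marked {d : Q.Black} (h : ¬ Q.marked d.1) :
    Q.blackRot.symm (Sum.inl d) = Sum.inl (Q.rotBlack.symm d) := by
  rw [Equiv.symm_apply_eq, blackRot_inl_of_not_marked, Equiv.apply_symm_apply]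
  rwa [← rotBlack_val, Equiv.apply_symm_apply]

theorem blackRot_symm_inr (d : {d : Q.H // Q.black d ∧ Q.marked d}) :
    Q.blackRot.symm (Sum.inr d) = Sum.inl (Q.rotBlack.symm ⟨d.1, d.2.1⟩) := by
  apply congrArg Sum.inl
  apply Subtype.ext
  rw [rotBlack_symm_val]

theorem faceOf_inr (d : {d : Q.H // Q.black d ∧ Q.marked d}) :
    Q.toIntermediate.faceOf (Sum.inl (Q.rotBlack.symm ⟨d.1, d.2.1⟩) : Q.Corner) =
      Q.toIntermediate.faceOf (Sum.inr d : Q.Corner) := by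
  have h1 := Q.toIntermediate.faceOf_faceStep (Sum.inr d : Q.Corner)
  rw [← h1]
  change _ = Q.toIntermediate.faceOf (Q.blackRot.symm (Sum.inr d))
  rw [blackRot_symm_inr]

/-- Crossing a cilium costs one more step but stays in the same face. Through `rot_flip`, this move
of black corners is the rotation around a white vertex. -/
theorem faceOf_opp (d : Q.Black) :
    Q.toIntermediate.faceOf (Sum.inl (Q.rotBlack.symm (Q.opp d)) : Q.Corner) =
      Q.toIntermediate.faceOf (Sum.inl d : Q.Corner) := by
  have h1 := Q.toIntermediate.faceOf_faceStep (Sum.inl d : Q.Corner)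
  rw [← h1]
  change _ = Q.toIntermediate.faceOf (Q.blackRot.symm (Sum.inl (Q.opp d)))
  by_cases h : Q.marked (Q.opp d).1
  · rw [blackRot_symm_inl_of_marked h, ← faceOf_inr]
  · rw [blackRot_symm_inl_of_not_marked h]

variable (Q) in
/-- The vertex of the quadrangulation at which a corner of the intermediate field graph sits. -/
def blackVertex : Q.Corner → Q.toRibbonGraph.Vertex :=
  Sum.elim (fun d => Q.vertexOf d.1) (fun d => Q.vertexOf d.1)

variable (Q) in
/-- The white vertex inside the face on the left of a half-edge of the intermediate field
graph. -/
def whiteVertex : Q.Corner → Q.toRibbonGraph.Vertex :=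
  Sum.elim (fun d => Q.vertexOf (Q.flip (Q.rot d.1))) (fun d => Q.vertexOf (Q.flip d.1))

theorem blackVertex_blackRot (x : Q.Corner) : Q.blackVertex (Q.blackRot x) = Q.blackVertex x := by
  obtain d | d := x
  · by_cases h : Q.marked (Q.rot d.1)
    · rw [blackRot_inl_of_marked h]
      exact Q.vertexOf_rot d.1
    · rw [blackRot_inl_of_not_marked h]
      exact Q.vertexOf_rot d.1
  · rfl

/-- The left side of `inl d` borders the edge of `rot d`, while the cilium `inr d` lies on the edge
of `d` itself; this shift in `whiteVertex` makes it constant along a face, with or without cilia. -/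
theorem whiteVertex_faceStep (x : Q.Corner) :
    Q.whiteVertex (Q.blackRot.symm (Q.blackFlip x)) = Q.whiteVertex x := by
  obtain d | d := x
  · have key : Q.vertexOf (Q.flip (Q.opp d).1) = Q.vertexOf (Q.flip (Q.rot d.1)) := by
      rw [opp_val, ← rot_faceStep, faceStep_three, Q.vertexOf_rot]
    rw [blackFlip_inl]
    by_cases h : Q.marked (Q.opp d).1
    · rw [blackRot_symm_inl_of_marked h]
      exact key
    · rw [blackRot_symm_inl_of_not_marked h]
      change Q.vertexOf (Q.flip (Q.rot (Q.rotBlack.symm (Q.opp d)).1)) = _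
      rw [rotBlack_symm_val, Equiv.apply_symm_apply]
      exact key
  · change Q.whiteVertex (Q.blackRot.symm (Sum.inr d)) = _
    rw [blackRot_symm_inr]
    change Q.vertexOf (Q.flip (Q.rot (Q.rotBlack.symm _).1)) = Q.vertexOf (Q.flip d.1)
    rw [rotBlack_symm_val, Equiv.apply_symm_apply]

open Classical in
variable (Q) in
/-- The vertex or the face of the intermediate field graph given by the vertex of a half-edge. -/
noncomputable def vertexOrFace (h : Q.H) : Q.toIntermediate.Vertex ⊕ Q.toIntermediate.Face :=
  if hb : Q.black h then Sum.inl (Q.toIntermediate.vertexOf (Sum.inl ⟨h, hb⟩ : Q.Corner))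
  else Sum.inr (Q.toIntermediate.faceOf
    (Sum.inl ⟨Q.faceStep h, (Q.black_faceStep h).2 hb⟩ : Q.Corner))

theorem vertexOrFace_black (d : Q.Black) :
    Q.vertexOrFace d.1 = Sum.inl (Q.toIntermediate.vertexOf (Sum.inl d : Q.Corner)) :=
  dif_pos d.2

theorem vertexOrFace_flip (d : Q.Black) :
    Q.vertexOrFace (Q.flip d.1) =
      Sum.inr (Q.toIntermediate.faceOf (Sum.inl (Q.rotBlack.symm d) : Q.Corner)) := by
  have hb : ¬ Q.black (Q.flip d.1) := by
    rw [Q.black_flip, not_not]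
    exact d.2
  have h : (⟨Q.faceStep (Q.flip d.1), (Q.black_faceStep _).2 hb⟩ : Q.Black) =
      Q.rotBlack.symm d := by
    apply Subtype.ext
    rw [rotBlack_symm_val]
    exact faceStep_flip d.1
  rw [vertexOrFace, dif_neg hb, h]

theorem vertexOrFace_rot (h : Q.H) : Q.vertexOrFace (Q.rot h) = Q.vertexOrFace h := by
  obtain ⟨d, rfl | rfl⟩ := eq_black_or_eq_flip_black h
  · rw [← rotBlack_val, vertexOrFace_black, vertexOrFace_black, vertexOf_rotBlack]
  · rw [rot_flip, ← rotBlack_symm_val, ← opp_val, vertexOrFace_flip, vertexOrFace_flip,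
      faceOf_opp]

variable (Q) in
/-- The white vertices are the faces of the intermediate field graph. -/
noncomputable def vertexEquiv :
    Q.toIntermediate.Vertex ⊕ Q.toIntermediate.Face ≃ Q.toRibbonGraph.Vertex where
  toFun := Sum.elim
    (Quotient.lift Q.blackVertex fun _ _ =>
      have := Q.toIntermediate.finite_H
      eq_of_sameCycle (σ := Q.toIntermediate.rot) blackVertex_blackRot)
    (Quotient.lift Q.whiteVertex fun _ _ =>
      have := Q.toIntermediate.finite_H
      eq_of_sameCycle (σ := Q.toIntermediate.faceStep) whiteVertex_faceStep)
  invFun := Quotient.lift Q.vertexOrFace fun _ _ =>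
    have := Q.finite_H
    eq_of_sameCycle vertexOrFace_rot
  left_inv := by
    rintro (v | v) <;> induction v using Quotient.inductionOn with | _ x <;>
      obtain (d | d) : Q.Corner := x
    · exact vertexOrFace_black d
    · exact (vertexOrFace_black ⟨d.1, d.2.1⟩).trans (congrArg Sum.inl (vertexOf_inr d))
    · refine (vertexOrFace_flip (Q.rotBlack d)).trans ?_
      rw [Equiv.symm_apply_apply]
      rfl
    · exact (vertexOrFace_flip ⟨d.1, d.2.1⟩).trans (congrArg Sum.inr (faceOf_inr d))
  right_inv := by
    rintro ⟨h⟩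
    obtain ⟨d, rfl | rfl⟩ := eq_black_or_eq_flip_black h
    · change Sum.elim _ _ (Q.vertexOrFace d.1) = Q.vertexOf d.1
      rw [vertexOrFace_black]
      rfl
    · change Sum.elim _ _ (Q.vertexOrFace (Q.flip d.1)) = Q.vertexOf (Q.flip d.1)
      rw [vertexOrFace_flip]
      change Q.vertexOf (Q.flip (Q.rot (Q.rotBlack.symm d).1)) = _
      rw [rotBlack_symm_val, Equiv.apply_symm_apply]

theorem toIntermediate_hasGenus_iff {g : ℕ} : Q.toIntermediate.HasGenus g ↔ Q.HasGenus g := by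
  have h1 := Nat.card_congr Q.vertexEquiv
  rw [Nat.card_sum] at h1
  have h2 := Q.ncard_black
  have h3 := Q.ncard_black_eq_ncard_edges
  have h4 := Q.card_face
  rw [RibbonGraph.HasGenus, RibbonGraph.HasGenus]
  omega

theorem toIntermediate_iso {Q' : MarkedQuadrangulation} (h : Q.Iso Q') :
    Q.toIntermediate.Iso Q'.toIntermediate := by
  obtain ⟨e, hr, hf, hb, hm⟩ := h
  have hs : ∀ x, e (Q.faceStep x) = Q'.faceStep (e x) := fun x => by
    rw [← Q'.rot.apply_eq_iff_eq, rot_faceStep, ← hr, rot_faceStep, hf]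
  let eB : Q.Black ≃ Q'.Black := e.subtypeEquiv fun a => (hb a).symm
  let eM : {d : Q.H // Q.black d ∧ Q.marked d} ≃ {d : Q'.H // Q'.black d ∧ Q'.marked d} :=
    e.subtypeEquiv fun a => and_congr (hb a).symm (hm a).symm
  let E : Q.Corner ≃ Q'.Corner := eB.sumCongr eM
  refine ⟨E, ?_, ?_⟩
  · rintro (d | d)
    · change E (Q.blackRot (Sum.inl d)) = Q'.blackRot (Sum.inl (eB d))
      have hm' : Q'.marked (Q'.rot (eB d).1) ↔ Q.marked (Q.rot d.1) := by
        rw [← hm, hr]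
        rfl
      by_cases h : Q.marked (Q.rot d.1)
      · rw [blackRot_inl_of_marked h, blackRot_inl_of_marked (hm'.2 h)]
        exact congrArg Sum.inr (Subtype.ext (hr d.1))
      · rw [blackRot_inl_of_not_marked h, blackRot_inl_of_not_marked (mt hm'.1 h)]
        exact congrArg Sum.inl (Subtype.ext (hr d.1))
    · rfl
  · rintro (d | d)
    · change (Sum.inl (eB (Q.opp d)) : Q'.Corner) = Sum.inl (Q'.opp (eB d))
      refine congrArg Sum.inl (Subtype.ext ?_)
      change e (Q.faceStep (Q.faceStep d.1)) = Q'.faceStep (Q'.faceStep (e d.1))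
      rw [hs, hs]
    · rfl

/-! ### Reconstruction of a quadrangulation from its intermediate graph. -/

section Extend

variable {Q' : MarkedQuadrangulation}

open Classical in
/-- Extension of a map between the black half-edges to all half-edges. -/
noncomputable def extend (a : Q.Black → Q'.Black) (h : Q.H) : Q'.H :=
  if hb : Q.black h then (a ⟨h, hb⟩).1 else Q'.flip (a ⟨Q.flip h, (Q.black_flip h).2 hb⟩).1

theorem extend_black (a : Q.Black → Q'.Black) (d : Q.Black) : extend a d.1 = (a d).1 :=
  dif_pos d.2

theorem extend_flip_black (a : Q.Black → Q'.Black) (d : Q.Black) :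
    extend a (Q.flip d.1) = Q'.flip (a d).1 := by
  have hb : ¬ Q.black (Q.flip d.1) := by
    rw [Q.black_flip, not_not]
    exact d.2
  rw [extend, dif_neg hb]
  simp only [Q.flip_flip]

theorem extend_extend {a : Q.Black → Q'.Black} {b : Q'.Black → Q.Black} (h : ∀ d, b (a d) = d)
    (x : Q.H) : extend b (extend a x) = x := by
  obtain ⟨d, rfl | rfl⟩ := eq_black_or_eq_flip_black x
  · rw [extend_black, extend_black, h]
  · rw [extend_flip_black, extend_flip_black, h]

/-- Each white half-edge is the flip of a black one, and its rotation is fixed by `opp` and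
`rotBlack` through `rot_flip`. -/
theorem iso_of_black_equiv (e : Q.Black ≃ Q'.Black)
    (hr : ∀ d, e (Q.rotBlack d) = Q'.rotBlack (e d)) (ho : ∀ d, e (Q.opp d) = Q'.opp (e d))
    (hm : ∀ d, Q'.marked (e d).1 ↔ Q.marked d.1) : Q.Iso Q' := by
  have hs : ∀ d, e (Q.rotBlack.symm d) = Q'.rotBlack.symm (e d) := fun d => by
    rw [Equiv.eq_symm_apply, ← hr, Equiv.apply_symm_apply]
  refine ⟨⟨extend e, extend e.symm, extend_extend e.symm_apply_apply,
    extend_extend e.apply_symm_apply⟩, fun h => ?_, fun h => ?_, fun h => ?_, fun h => ?_⟩ <;>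
  simp only [Equiv.coe_fn_mk] <;>
  obtain ⟨d, rfl | rfl⟩ := eq_black_or_eq_flip_black h
  · rw [← rotBlack_val, extend_black, extend_black, hr, rotBlack_val]
  · rw [rot_flip, ← rotBlack_symm_val, ← opp_val, extend_flip_black, extend_flip_black, ho, hs,
      rot_flip, opp_val, rotBlack_symm_val]
  · rw [extend_flip_black, extend_black]
  · rw [Q.flip_flip, extend_flip_black, extend_black, Q'.flip_flip]
  · rw [extend_black]
    exact iff_of_true (e d).2 d.2
  · rw [extend_flip_black, Q'.black_flip, Q.black_flip]
    exact not_congr (iff_of_true (e d).2 d.2)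
  · rw [extend_black, hm]
  · rw [extend_flip_black, Q'.marked_flip, Q.marked_flip, hm]

theorem iso_of_toIntermediate_iso (h : Q.toIntermediate.Iso Q'.toIntermediate) : Q.Iso Q' := by
  obtain ⟨E, hr, hf⟩ := h
  change Q.Corner ≃ Q'.Corner at E
  replace hr : ∀ x : Q.Corner, E (Q.blackRot x) = Q'.blackRot (E x) := hr
  replace hf : ∀ x : Q.Corner, E (Q.blackFlip x) = Q'.blackFlip (E x) := hf
  have hcil : ∀ x : Q.Corner, Q'.toIntermediate.IsCilium (E x) ↔ Q.toIntermediate.IsCilium x := by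
    intro x
    change Q'.blackFlip (E x) = E x ↔ Q.blackFlip x = x
    rw [← hf, E.apply_eq_iff_eq]
  have hinl : ∀ d : Q.Black, ∃ d' : Q'.Black, E (Sum.inl d) = Sum.inl d' := fun d => by
    rcases h : E (Sum.inl d) with d' | d'
    · exact ⟨d', rfl⟩
    · exact absurd ((hcil _).1 (h ▸ isCilium_inr d')) (not_isCilium_inl d)
  have hinl' : ∀ d' : Q'.Black, ∃ d : Q.Black, E (Sum.inl d) = Sum.inl d' := fun d' => by
    rcases h : E.symm (Sum.inl d') with d | d
    · exact ⟨d, by rw [← h, E.apply_symm_apply]⟩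
    · have := (hcil _).2 (isCilium_inr d)
      rw [← h, E.apply_symm_apply] at this
      exact absurd this (not_isCilium_inl d')
  choose a ha using hinl
  choose b hb using hinl'
  let e : Q.Black ≃ Q'.Black :=
    { toFun := a
      invFun := b
      left_inv := fun d => Sum.inl_injective (E.injective (by rw [hb, ha]))
      right_inv := fun d => Sum.inl_injective (by rw [← ha, hb]) }
  -- The edge of `rot d` is marked exactly when a cilium follows `inl d`, and an isomorphism
  -- preserves cilia. One further rotation passes the cilium and reaches the next corner.
  have key : ∀ d, (Q'.marked (Q'.rot (a d).1) ↔ Q.marked (Q.rot d.1)) ∧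
      a (Q.rotBlack d) = Q'.rotBlack (a d) := fun d => by
    have h1 := hr (Sum.inl d)
    rw [ha] at h1
    by_cases h : Q.marked (Q.rot d.1) <;> by_cases h' : Q'.marked (Q'.rot (a d).1)
    · rw [blackRot_inl_of_marked h, blackRot_inl_of_marked h'] at h1
      have h2 := hr (Sum.inr ⟨Q.rot d.1, (Q.rotBlack d).2, h⟩)
      rw [h1, blackRot_inr, blackRot_inr] at h2
      exact ⟨iff_of_true h' h, Sum.inl_injective ((ha _).symm.trans h2)⟩
    · rw [blackRot_inl_of_marked h, blackRot_inl_of_not_marked h'] at h1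
      exact absurd ((hcil _).2 (isCilium_inr _)) (h1 ▸ not_isCilium_inl _)
    · rw [blackRot_inl_of_not_marked h, blackRot_inl_of_marked h', ha] at h1
      cases h1
    · rw [blackRot_inl_of_not_marked h, blackRot_inl_of_not_marked h', ha] at h1
      exact ⟨iff_of_false h' h, Sum.inl_injective h1⟩
  refine iso_of_black_equiv e (fun d => (key d).2) (fun d => ?_) fun d => ?_
  · have h1 := hf (Sum.inl d)
    rw [ha, blackFlip_inl, blackFlip_inl, ha] at h1
    exact Sum.inl_injective h1
  · have h1 := key (Q.rotBlack.symm d)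
    rw [Equiv.apply_symm_apply] at h1
    rw [← rotBlack_val, ← h1.2, ← rotBlack_val, Equiv.apply_symm_apply] at h1
    exact h1.1

end Extend

end MarkedQuadrangulation

/-! ### The quadrangulation surrounding the edges of a ribbon graph. -/

namespace RibbonGraph

variable (A : RibbonGraph)

/-- Half-edges that belong to an edge. -/
abbrev EdgeEnd : Type := {h : A.H // ¬ A.IsCilium h}

variable {A}

theorem isCilium_flip_iff (h : A.H) : A.IsCilium (A.flip h) ↔ A.IsCilium h :=
  A.flip.apply_eq_iff_eq

variable (A) in
def flipEnd : Equiv.Perm A.EdgeEnd :=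
  A.flip.subtypePerm fun h => not_congr (isCilium_flip_iff h)

theorem flipEnd_flipEnd (h : A.EdgeEnd) : A.flipEnd (A.flipEnd h) = h :=
  Subtype.ext (A.flip_flip h.1)

theorem flipEnd_ne (h : A.EdgeEnd) : A.flipEnd h ≠ h :=
  fun k => h.2 (congrArg Subtype.val k)

theorem not_isCilium_rot_symm (hA : ∀ c, A.IsCilium c → ¬ A.IsCilium (A.rot c)) {h : A.H}
    (hh : A.IsCilium h) : ¬ A.IsCilium (A.rot.symm h) := fun k =>
  hA _ k (by rwa [Equiv.apply_symm_apply])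

open Classical in
/-- The rotation with the cilia skipped. -/
noncomputable def skipRot (hA : ∀ c, A.IsCilium c → ¬ A.IsCilium (A.rot c)) :
    Equiv.Perm A.EdgeEnd where
  toFun h := if k : A.IsCilium (A.rot h.1) then ⟨A.rot (A.rot h.1), hA _ k⟩ else ⟨A.rot h.1, k⟩
  invFun h := if k : A.IsCilium (A.rot.symm h.1) then
    ⟨A.rot.symm (A.rot.symm h.1), not_isCilium_rot_symm hA k⟩ else ⟨A.rot.symm h.1, k⟩
  left_inv h := by
    by_cases k : A.IsCilium (A.rot h.1)
    · simp [k]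
    · simp [k, h.2]
  right_inv h := by
    by_cases k : A.IsCilium (A.rot.symm h.1)
    · simp [k]
    · simp [k, h.2]

theorem skipRot_of_isCilium (hA : ∀ c, A.IsCilium c → ¬ A.IsCilium (A.rot c)) {h : A.EdgeEnd}
    (k : A.IsCilium (A.rot h.1)) : (skipRot hA h).1 = A.rot (A.rot h.1) :=
  congrArg Subtype.val (dif_pos k)

theorem skipRot_of_not_isCilium (hA : ∀ c, A.IsCilium c → ¬ A.IsCilium (A.rot c))
    {h : A.EdgeEnd} (k : ¬ A.IsCilium (A.rot h.1)) : (skipRot hA h).1 = A.rot h.1 :=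
  congrArg Subtype.val (dif_neg k)

/-- The quadrangulation whose faces surround the edges of `A`: the half-edge `(h, true)` joins
the vertex of `h` to the face on the right of `h`. -/
noncomputable def toQuadrangulation (hA : ∀ c, A.IsCilium c → ¬ A.IsCilium (A.rot c)) :
    MarkedQuadrangulation where
  H := A.EdgeEnd × Bool
  finite_H := by
    have := A.finite_H
    infer_instance
  rot :=
    -- The white rotation is forced by `rot_flip`, with `skipRot` as black rotation and `flipEnd` as
    -- exchange of black corners.
    { toFun := fun x => if x.2 then (skipRot hA x.1, true)
        else (A.flipEnd ((skipRot hA).symm x.1), false)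
      invFun := fun x => if x.2 then ((skipRot hA).symm x.1, true)
        else (skipRot hA (A.flipEnd x.1), false)
      left_inv := by rintro ⟨h, _ | _⟩ <;> simp [flipEnd_flipEnd]
      right_inv := by rintro ⟨h, _ | _⟩ <;> simp [flipEnd_flipEnd] }
  flip := (Equiv.refl _).prodCongr Equiv.boolNot
  flip_flip := by rintro ⟨h, b⟩; simp
  black x := x.2 = true
  marked x := A.IsCilium (A.rot.symm x.1.1)
  flip_ne := by rintro ⟨h, b⟩; simp
  black_rot := by rintro ⟨h, _ | _⟩ <;> simp
  black_flip := by rintro ⟨h, _ | _⟩ <;> simp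
  marked_flip _ := Iff.rfl
  face_degree := by
    rintro ⟨h, b⟩
    -- The period divides 4 but not 2: two face steps act, up to conjugation by `skipRot`, as
    -- `flipEnd`, an involution without fixed points.
    refine Nat.eq_prime_pow_of_dvd_least_prime_pow (k := 1) Nat.prime_two ?_ ?_
    · rw [← Function.isPeriodicPt_iff_minimalPeriod_dvd]
      cases b
      · simpa [Function.IsPeriodicPt, Function.IsFixedPt] using
          fun k => flipEnd_ne _ ((skipRot hA).eq_symm_apply.2 k)
      · simp [Function.IsPeriodicPt, Function.IsFixedPt, flipEnd_ne]
    · apply Function.IsPeriodicPt.minimalPeriod_dvd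
      cases b <;>
        simp [Function.IsPeriodicPt, Function.IsFixedPt, flipEnd_flipEnd]

theorem toQuadrangulation_toIntermediate_iso
    (hA : ∀ c, A.IsCilium c → ¬ A.IsCilium (A.rot c)) :
    (toQuadrangulation hA).toIntermediate.Iso A := by
  let Q := toQuadrangulation hA
  -- A mark on the edge of `h` stands for the cilium just clockwise of `h`. Every cilium `c` arises
  -- so, from `A.rot c`, which is not a cilium by `hA`.
  let f : Q.Corner → A.H := Sum.elim (fun d => d.1.1.1) (fun d => A.rot.symm d.1.1.1)
  have hrot : ∀ d : Q.Black, Q.rotBlack d = ⟨(skipRot hA d.1.1, true), rfl⟩ := by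
    rintro ⟨⟨h, b⟩, hb⟩
    cases (show b = true from hb)
    rfl
  have hopp : ∀ d : Q.Black, (Q.opp d).1.1 = A.flipEnd d.1.1 := by
    rintro ⟨⟨h, b⟩, hb⟩
    cases (show b = true from hb)
    exact (skipRot hA).symm_apply_apply _
  have hbij : Function.Bijective f := by
    constructor
    · rintro (⟨⟨h, b⟩, hb⟩ | ⟨⟨h, b⟩, hb, hm⟩) (⟨⟨h', b'⟩, hb'⟩ | ⟨⟨h', b'⟩, hb', hm'⟩) heq
      all_goals
        cases (show b = true from hb)
        cases (show b' = true from hb')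
      · cases (Subtype.ext heq : h = h')
        rfl
      · exact absurd ((show h.1 = A.rot.symm h'.1 from heq) ▸ hm') h.2
      · exact absurd ((show A.rot.symm h.1 = h'.1 from heq) ▸ hm) h'.2
      · cases (Subtype.ext (A.rot.symm.injective heq) : h = h')
        rfl
    · intro h
      by_cases hc : A.IsCilium h
      · refine ⟨Sum.inr ⟨(⟨A.rot h, hA h hc⟩, true), rfl, ?_⟩, A.rot.symm_apply_apply h⟩
        change A.IsCilium (A.rot.symm (A.rot h))
        rwa [Equiv.symm_apply_apply]
      · exact ⟨Sum.inl ⟨(⟨h, hc⟩, true), rfl⟩, rfl⟩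
  refine ⟨Equiv.ofBijective f hbij, ?_, ?_⟩
  · rintro (d | d)
    · change f (Q.blackRot (Sum.inl d)) = A.rot d.1.1.1
      have hm : Q.marked (Q.rot d.1) ↔ A.IsCilium (A.rot.symm (skipRot hA d.1.1).1) := by
        rw [← MarkedQuadrangulation.rotBlack_val, hrot]
        rfl
      by_cases k : A.IsCilium (A.rot d.1.1.1)
      · have hs := skipRot_of_isCilium hA k
        have hm' : Q.marked (Q.rot d.1) := by
          rwa [hm, hs, Equiv.symm_apply_apply]
        rw [MarkedQuadrangulation.blackRot_inl_of_marked hm']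
        change A.rot.symm (Q.rotBlack d).1.1.1 = _
        rw [hrot, hs, Equiv.symm_apply_apply]
      · have hs := skipRot_of_not_isCilium hA k
        have hm' : ¬ Q.marked (Q.rot d.1) := by
          rw [hm, hs, Equiv.symm_apply_apply]
          exact d.1.1.2
        rw [MarkedQuadrangulation.blackRot_inl_of_not_marked hm', hrot]
        exact hs
    · exact (A.rot.apply_symm_apply _).symm
  · rintro (d | d)
    · exact congrArg Subtype.val (hopp d)
    · exact d.2.2.symm

end RibbonGraph

end IntermediateField

/-! ### The two bijections on isomorphism classes. -/

open IntermediateField in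
theorem mainTheorem9 :
    (∀ n m : ℕ, 0 < n + m →
      ∃ e : Quotient (IntermediateField.altSetoid n m) ≃
          Quotient (IntermediateField.ciliatedSetoid n m),
        (∀ G : IntermediateField.AltFamily n m,
          ∃ A : IntermediateField.CiliatedFamily n m,
            A.1 = G.1.toIntermediate ∧ e (Quotient.mk _ G) = Quotient.mk _ A) ∧
        (∀ A : IntermediateField.CiliatedFamily n m,
          ∃ G : IntermediateField.AltFamily n m,
            G.1 = A.1.expand ∧ e.symm (Quotient.mk _ A) = Quotient.mk _ G)) ∧
    (∀ g n m : ℕ, 0 < n →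
      ∃ e : Quotient (IntermediateField.quadrangulationSetoid g n m) ≃
          Quotient (IntermediateField.genusCiliatedSetoid g n m),
        ∀ Q : IntermediateField.QuadrangulationFamily g n m,
          ∃ A : IntermediateField.GenusCiliatedFamily g n m,
            A.1 = Q.1.toIntermediate ∧ e (Quotient.mk _ Q) = Quotient.mk _ A) := by
  refine ⟨fun n m _ => ?_, fun g n m hn => ?_⟩
  · let F : AltFamily n m → CiliatedFamily n m := fun G => ⟨G.1.toIntermediate,
      AltGraph.toIntermediate_connected_iff.2 G.2.1,
      AltGraph.toIntermediate_atMostOneCiliumPerVertex,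
      AltGraph.ncard_edges_toIntermediate.trans G.2.2.1, by
        have h1 := G.1.ncard_legs
        have h2 := G.2.2.2
        omega⟩
    let E : CiliatedFamily n m → AltFamily n m := fun A => by
      have hi := RibbonGraph.toIntermediate_expand_iso A.2.2.1
      refine ⟨A.1.expand, AltGraph.toIntermediate_connected_iff.1 (RibbonGraph.Iso.connected (RibbonGraph.iso_equivalence.symm hi) A.2.1),
        ?_, ?_⟩
      · rw [← AltGraph.ncard_edges_toIntermediate, hi.ncard_edges, A.2.2.2.1]
      · rw [AltGraph.ncard_legs, RibbonGraph.ncard_ciliatedVertices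
          AltGraph.toIntermediate_atMostOneCiliumPerVertex, hi.ncard_cilia,
          ← RibbonGraph.ncard_ciliatedVertices A.2.2.1, A.2.2.2.2]
    refine ⟨⟨Quotient.map F fun _ _ => AltGraph.toIntermediate_iso,
      Quotient.map E fun _ _ => RibbonGraph.expand_iso, ?_, ?_⟩,
      fun G => ⟨F G, rfl, rfl⟩, fun A => ⟨E A, rfl, rfl⟩⟩
    · rintro ⟨G⟩
      exact Quotient.sound AltGraph.expand_toIntermediate_iso
    · rintro ⟨A⟩
      exact Quotient.sound (RibbonGraph.toIntermediate_expand_iso A.2.2.1)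
  · let F : QuadrangulationFamily g n m → GenusCiliatedFamily g n m := fun Q =>
      ⟨Q.1.toIntermediate, MarkedQuadrangulation.toIntermediate_connected_iff.2 Q.2.1,
        MarkedQuadrangulation.toIntermediate_hasGenus_iff.2 Q.2.2.1,
        MarkedQuadrangulation.toIntermediate_atMostOneCiliumPerCorner,
        MarkedQuadrangulation.card_face.symm.trans Q.2.2.2.1,
        MarkedQuadrangulation.ncard_markedEdges.symm.trans Q.2.2.2.2⟩
    refine ⟨Equiv.ofBijective
      (Quotient.map F fun _ _ => MarkedQuadrangulation.toIntermediate_iso) ⟨?_, ?_⟩,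
      fun Q => ⟨F Q, rfl, rfl⟩⟩
    · rintro ⟨Q⟩ ⟨Q'⟩ h
      exact Quotient.sound (MarkedQuadrangulation.iso_of_toIntermediate_iso (Quotient.exact h))
    · rintro ⟨A, hc, hg, hA, he, hm⟩
      -- Positivity of `n` supplies the edge that excludes a cilium alone at its vertex.
      have hA' : ∀ c, A.IsCilium c → ¬ A.IsCilium (A.rot c) := fun c =>
        RibbonGraph.not_isCilium_rot hc hA (he ▸ hn)
      have hi := RibbonGraph.toQuadrangulation_toIntermediate_iso hA'
      have hi' := RibbonGraph.iso_equivalence.symm hi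
      exact ⟨Quotient.mk _ ⟨RibbonGraph.toQuadrangulation hA',
        MarkedQuadrangulation.toIntermediate_connected_iff.1 (hi'.connected hc),
        MarkedQuadrangulation.toIntermediate_hasGenus_iff.1 (hi'.hasGenus hg),
        by rw [MarkedQuadrangulation.card_face, hi.ncard_edges, he],
        by rw [MarkedQuadrangulation.ncard_markedEdges, hi.ncard_cilia, hm]⟩,
        Quotient.sound hi⟩
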